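/- Let $G$ be a countable discrete group and let $\Sigma=(\sigma_n:G\to\mathrm{Sym}(V_n))_{n\ge 1}$ be a sofic approximation to $G$: each $V_n$ is a nonempty finite set and, as $n\to\infty$, for all $g,h\in G$ one has $\sigma_n^g(\sigma_n^h(v))=\sigma_n^{gh}(v)$ for a proportion tending to $1$ of the $v\in V_n$, and for each $g\ne e$ one has $\sigma_n^g(v)\neq v$ for a proportion tending to $1$ of the $v\in V_n$. A \emph{compact generating metric} on a standard Borel space $\mathcal X$ is a compact metric $d$ whose Borel $\sigma$-algebra is that of $\mathcal X$. Let $d$ be one, give $\mathcal X$ its topology and $\mathcal X^G$ the product topology, and let $\mu$ be a probability measure on $\mathcal X^G$ invariant under the right shift $(x_h)_h\mapsto(x_{hg})_h$. For $\sigma:G\to\mathrm{Sym}(V)$, $v\in V$ and $\mathbf x\in\mathcal X^{V}$ let $\Pi^{\sigma}_v(\mathbf x)=(x_{\sigma^g(v)})_{g\in G}$ and $P^\sigma_{\mathbf x}=\frac1{|V|}\sum_{v\in V}\delta_{\Pi^\sigma_v(\mathbf x)}$. Probability measures $\mu_n$ on $\mathcal X^{V_n}$ \emph{quenched converge} to $\mu$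 over $(\sigma_n)$ if for every weak$^*$-neighbourhood $\mathcal O$ of $\mu$, (i) $(\Pi^{\sigma_n}_v)_*\mu_n\in\mathcal O$ for a proportion tending to $1$ of the $v\in V_n$, and (ii) $\mu_n\{\mathbf x: P^{\sigma_n}_{\mathbf x}\in\mathcal O\}\to1$. They \emph{doubly-quenched converge} to $\mu$, written $\mu_n\stackrel{\mathrm{dq}}{\to}\mu$, if $\mu_n\times\mu_n$ quenched converges to $\mu\times\mu$, regarded as measures on $(\mathcal X\times\mathcal X)^{V_n}$ and $(\mathcal X\times\mathcal X)^G$. Let $d^{(V)}(\mathbf x,\mathbf y)=\frac1{|V|}\sum_{v\in V}d(x_v,y_v)$ and let $\mathrm{cov}_{\varepsilon,\delta}(\nu,d^{(V)})$ be the least cardinality of a set $F\subseteq\mathcal X^V$ whose open $\delta$-neighbourhood has $\nu$-measure greater than $1-\varepsilon$. Define, in $[-\infty,+\infty]$ with $\sup\emptyset=-\infty$, \[ \mathrm h^{\mathrm{dq}}_\Sigma(\mu)=\sup\Big\{\sup_{\varepsilon,\delta>0}\limsup_{i\to\infty}\frac1{|V_{n_i}|}\log\mathrm{cov}_{\varepsilon,\delta}\big(\mu_i,d^{(V_{n_i})}\big)\;:\;n_1<n_2<\cdots,\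 \mu_i\stackrel{\mathrm{dq}}{\to}\mu\text{ over }(\sigma_{n_i})_{i\ge1}\Big\}. \] For a $G$-system $(X,\mu,T)$ (a measurable, measure-preserving action $T$ of $G$ on a standard Borel probability space) define $\mathrm h^{\mathrm{dq}}_\Sigma(\mu,T)$ to be $\mathrm h^{\mathrm{dq}}_\Sigma(\Phi_*\mu)$, where $\Phi:X\to X^G$, $\Phi(x)=(T^hx)_{h\in G}$, and $X$ carries a compact generating metric. Then for every $G$-system $(X,\mu,T)$ and every $k\ge1$, \[ \mathrm h^{\mathrm{dq}}_\Sigma(\mu^{\times k},T^{\times k})=k\cdot\mathrm h^{\mathrm{dq}}_\Sigma(\mu,T), \] and likewise $\mathrm h^{\mathrm{dq}}_\Sigma(\mu^{\times k})=k\cdot\mathrm h^{\mathrm{dq}}_\Sigma(\mu)$ for every shift-invariant probability measure $\mu$ on $\mathcal X^G$, where $\mu^{\times k}$ is regarded as a measure on $(\mathcal X^k)^G$. Here $k\cdot(\pm\infty)=\pm\infty$, and in both cases the equality holds for every choice of a compact generating metric on $X$ (resp. $\mathcal X$) and every choice of a compact generating metric on $X^k$ (resp. $\mathcal X^k$) used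 to compute the two sides. -/

import Mathlib

open MeasureTheory Filter Topology Function
open scoped ENNReal

namespace SoficEntropy

universe u v

/-- For a sequence of nonempty finite sets `V n` (with their uniform measures), the property `P n`
holds with high probability in `v ∈ V n` as `n → ∞`. -/
def WHP {V : ℕ → Type} [∀ n, Fintype (V n)] (P : ∀ n, V n → Prop) : Prop :=
  Tendsto (fun n => ({v | P n v}.ncard : ℝ) / (Fintype.card (V n) : ℝ)) atTop (𝓝 1)

/-- A sofic approximation to `G`: maps `σ n : G → Sym (V n)`, with each `V n` finite and nonempty,
which are asymptotically multiplicative and asymptotically free at most vertices. -/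
structure SoficApproximation (G : Type u) [Group G] where
  V : ℕ → Type
  [fintypeV : ∀ n, Fintype (V n)]
  [nonemptyV : ∀ n, Nonempty (V n)]
  σ : ∀ n, G → Equiv.Perm (V n)
  asymp_mul : ∀ g h : G, WHP fun n v => σ n g (σ n h v) = σ n (g * h) v
  asymp_free : ∀ g : G, g ≠ 1 → WHP fun n v => σ n g v ≠ v

attribute [instance] SoficApproximation.fintypeV SoficApproximation.nonemptyV

/-- The sofic sub-approximation along a subsequence `n 0 < n 1 < ⋯`. -/
def SoficApproximation.sub {G : Type u} [Group G] (S : SoficApproximation G) (n : ℕ → ℕ)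
    (hn : StrictMono n) : SoficApproximation G where
  V i := S.V (n i)
  σ i := S.σ (n i)
  asymp_mul g h := (S.asymp_mul g h).comp hn.tendsto_atTop
  asymp_free g hg := (S.asymp_free g hg).comp hn.tendsto_atTop

section Models

variable {G : Type u} {V : Type} {X : Type v}

/-- The pullback name of `x ∈ X^V` at the vertex `v`. -/
def pullbackName (σ : G → Equiv.Perm V) (v : V) (x : V → X) : G → X :=
  fun g => x (σ g v)

theorem measurable_pullbackName [MeasurableSpace X] (σ : G → Equiv.Perm V) (v : V) :
    Measurable (pullbackName (X := X) σ v) :=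
  measurable_pi_lambda _ fun g => measurable_pi_apply (σ g v)

/-- The empirical distribution `|V|⁻¹ ∑ v, δ_{Π_v(x)}` of `x ∈ X^V`. -/
noncomputable def empirical [MeasurableSpace X] [Fintype V] [Nonempty V]
    (σ : G → Equiv.Perm V) (x : V → X) : ProbabilityMeasure (G → X) :=
  ⟨(Fintype.card V : ℝ≥0∞)⁻¹ • ∑ v : V, Measure.dirac (pullbackName σ v x), ⟨by
    simp [ENNReal.inv_mul_cancel]⟩⟩

/-- The set of `O`-good models over `σ`. -/
def goodModels [MeasurableSpace X] [Fintype V] [Nonempty V]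
    (O : Set (ProbabilityMeasure (G → X))) (σ : G → Equiv.Perm V) : Set (V → X) :=
  {x | empirical σ x ∈ O}

end Models

section Convergence

variable {G : Type u} [Group G] [Countable G] {X : Type v} [TopologicalSpace X]
  [SecondCountableTopology X] [MeasurableSpace X] [BorelSpace X]

/-- Local weak-* convergence over the sofic approximation `S`. Here `ProbabilityMeasure (G → X)`
carries its topology of weak convergence. -/
def LocalWeakConverges (S : SoficApproximation G) (m : ∀ n, ProbabilityMeasure (S.V n → X))
    (μ : ProbabilityMeasure (G → X)) : Prop :=
  ∀ O ∈ 𝓝 μ, WHP fun n (v : S.V n) =>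
    (m n).map (measurable_pullbackName (S.σ n) v).aemeasurable ∈ O

/-- Quenched convergence over the sofic approximation `S`. -/
def QuenchedConverges (S : SoficApproximation G) (m : ∀ n, ProbabilityMeasure (S.V n → X))
    (μ : ProbabilityMeasure (G → X)) : Prop :=
  LocalWeakConverges S m μ ∧
    ∀ O ∈ 𝓝 μ, Tendsto (fun n => (m n : Measure (S.V n → X)) (goodModels O (S.σ n))) atTop (𝓝 1)

end Convergence

section Products

variable {I : Type u} {X : Type v} [MeasurableSpace X]

/-- The canonical identification `X^I × X^I → (X × X)^I`. -/
def zipFun (p : (I → X) × (I → X)) : I → X × X := fun i => (p.1 i, p.2 i)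

theorem measurable_zipFun : Measurable (zipFun (I := I) (X := X)) :=
  measurable_pi_lambda _ fun i =>
    ((measurable_pi_apply i).comp measurable_fst).prodMk ((measurable_pi_apply i).comp measurable_snd)

/-- The Cartesian square `μ × μ`, as a measure on `(X × X)^I`. -/
noncomputable def square (μ : ProbabilityMeasure (I → X)) : ProbabilityMeasure (I → X × X) :=
  (μ.prod μ).map measurable_zipFun.aemeasurable

theorem measurable_swapFun (k : ℕ) :
    Measurable (fun (y : Fin k → I → X) (i : I) (j : Fin k) => y j i) :=
  measurable_pi_lambda _ fun i => measurable_pi_lambda _ fun j =>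
    (measurable_pi_apply i).comp (measurable_pi_apply j)

/-- The Cartesian power of a measure on `X^I`, as a measure on `(X^k)^I`. -/
noncomputable def power (k : ℕ) (μ : ProbabilityMeasure (I → X)) :
    ProbabilityMeasure (I → Fin k → X) :=
  (ProbabilityMeasure.pi fun _ : Fin k => μ).map (measurable_swapFun k).aemeasurable

end Products

/-- Doubly-quenched convergence: `m n × m n` quenched converges to `μ × μ`. -/
def DoublyQuenchedConverges {G : Type u} [Group G] [Countable G] {X : Type v} [TopologicalSpace X]
    [SecondCountableTopology X] [MeasurableSpace X] [BorelSpace X]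
    (S : SoficApproximation G) (m : ∀ n, ProbabilityMeasure (S.V n → X))
    (μ : ProbabilityMeasure (G → X)) : Prop :=
  QuenchedConverges S (fun n => square (m n)) (square μ)

/-- The Hamming average of the metric of `X` over the finite set `V`. -/
noncomputable def hammingAvg {V : Type} [Fintype V] {X : Type v} [MetricSpace X]
    (x y : V → X) : ℝ :=
  (∑ v, dist (x v) (y v)) / (Fintype.card V : ℝ)

/-- The `(ε, δ)`-covering number of the probability measure `m` on `X^V` for the Hamming average:
the least cardinality of a set `F` whose open `δ`-neighbourhood has measure greater than `1 - ε`. -/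
noncomputable def covNum {V : Type} [Fintype V] {X : Type v} [MetricSpace X] [MeasurableSpace X]
    (ε δ : ℝ) (m : ProbabilityMeasure (V → X)) : ℕ∞ :=
  ⨅ (F : Finset (V → X))
    (_ : 1 - ε < (m : Measure (V → X)).real {y | ∃ x ∈ F, hammingAvg x y < δ}), (F.card : ℕ∞)

/-- The doubly-quenched model-measure sofic entropy of the measure `μ` on `X^G`, with `X` a compact
metric space. The value is `⊥ = -∞` if no sequence of measures doubly-quenched converges to `μ`
over any subsequence of the sofic approximation. -/
noncomputable def dqEntropy {G : Type u} [Group G] [Countable G] {X : Type v} [MetricSpace X]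
    [CompactSpace X] [MeasurableSpace X] [BorelSpace X]
    (S : SoficApproximation G) (μ : ProbabilityMeasure (G → X)) : EReal :=
  ⨆ (n : ℕ → ℕ) (hn : StrictMono n) (m : ∀ i, ProbabilityMeasure ((S.sub n hn).V i → X))
    (_ : DoublyQuenchedConverges (S.sub n hn) m μ) (δ : ℝ) (_ : 0 < δ) (ε : ℝ) (_ : 0 < ε),
    limsup (fun i => ENNReal.log (covNum ε δ (m i) : ℝ≥0∞) /
      (Fintype.card ((S.sub n hn).V i) : EReal)) atTop

/-- A compact generating metric on a measurable space: a compact metric whose Borel σ-algebra is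
the given one. -/
structure CompactGeneratingMetric (X : Type v) [MeasurableSpace X] extends MetricSpace X where
  compactSpace : CompactSpace X
  borelSpace : BorelSpace X

/-- The doubly-quenched model-measure sofic entropy of the metric `G`-process `(X^G, μ, S, d)`. -/
noncomputable def processEntropy {G : Type u} [Group G] [Countable G] {X : Type v}
    [MeasurableSpace X] (S : SoficApproximation G) (d : CompactGeneratingMetric X)
    (μ : ProbabilityMeasure (G → X)) : EReal :=
  @dqEntropy G _ _ X d.toMetricSpace d.compactSpace _ d.borelSpace S μ

/-- Invariance of a measure on `X^G` under the right shift `(x_h)_h ↦ (x_{hg})_h`. -/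
def ShiftInvariant {G : Type u} [Group G] {X : Type v} [MeasurableSpace X]
    (μ : ProbabilityMeasure (G → X)) : Prop :=
  ∀ g : G, MeasurePreserving (fun (x : G → X) (h : G) => x (h * g))
    (μ : Measure (G → X)) (μ : Measure (G → X))

section Systems

variable {G : Type u} [Group G] {X : Type v} [MeasurableSpace X] [MulAction G X]

/-- The map `x ↦ (T^h x)_h`, which identifies a `G`-system with a `G`-process. -/
def orbitMap (x : X) : G → X := fun h => h • x

theorem measurable_orbitMap [MeasurableConstSMul G X] :
    Measurable (orbitMap (G := G) (X := X)) :=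
  measurable_pi_lambda _ fun h => measurable_const_smul h

/-- The `G`-process `(X^G, Φ_* μ)` isomorphic to the `G`-system `(X, μ)`, where `Φ` is the
orbit map. -/
noncomputable def toProcess (G : Type u) [Group G] {X : Type v} [MeasurableSpace X] [MulAction G X]
    [MeasurableConstSMul G X] (μ : ProbabilityMeasure X) : ProbabilityMeasure (G → X) :=
  μ.map (measurable_orbitMap (G := G)).aemeasurable

/-- The doubly-quenched model-measure sofic entropy of a `G`-system `(X, μ, T)`, computed from the
isomorphic process `(X^G, Φ_* μ)` and the compact generating metric `d` on `X`. -/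
noncomputable def systemEntropy [Countable G] [MeasurableConstSMul G X]
    (S : SoficApproximation G) (d : CompactGeneratingMetric X) (μ : ProbabilityMeasure X) : EReal :=
  processEntropy S d (toProcess G μ)

end Systems

end SoficEntropy

/-! Everything rests on a reformulation of doubly-quenched convergence as asymptotic decorrelation:
for all continuous `f`, `g` on `X^G`, and for most pairs of vertices `v`, `w`, the integral of
`f(Π_v x) g(Π_w x)` under `m n` is close to `∫ f dμ · ∫ g dμ`. If `f` has mean zero, the squared
correlations averaged over pairs are the integral, under the square of `m n`, of the product of the
empirical averages of `f ⊗ f` and `g ⊗ g`, and the first of these tends to `0` in mean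
(`DoublyQuenchedConverges.tendsto_pairDeviation`). Conversely, decorrelation gives the local means
and, by a second-moment estimate, the empirical averages; by Stone-Weierstrass it need only be
tested on a multiplicative family separating points (`doublyQuenchedConverges_of_submonoid`).

Decorrelation passes to Cartesian powers and to coordinatewise continuous images. Additivity for the
supremum metric follows. For `≤`, the `k` coordinate marginals of any sequence converging to `μ^k`
converge to `μ`, and products of their coverings cover (`covNum_le_prod`). For `≥`, use the powers
of a sequence converging to `μ`. After removing a union of few balls, a set of measure at least `ε`
is left on which each ball has measure at most `1/N`, so balls in the power have measure at most
`N^{-k}` on the `k`-th power of that set (`le_covNum_power`). The loss `ε^k/2` is negligible when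
`|V n| → ∞`; otherwise the one-coordinate marginal of `μ` is a point mass and the rates are at most
zero.

It remains to change the metric. Two compact generating metrics are related by a Borel isomorphism
`φ` which may be discontinuous, so its image of `m n` is not controlled by weak convergence. Instead
`φ` is replaced by finite-valued maps `ψ n`, chosen diagonally along the given sequence. The images
under `ψ n` still decorrelate, and their covering numbers bound the original ones because continuous
functions on `X` are nearly continuous functions of `ψ n` (`dqEntropy_le_dqEntropy_mapCoord`). -/

namespace SoficEntropy

set_option linter.unusedSectionVars false

open scoped BigOperators

/-! ### Uniform averages over finite sets. -/

section Averages

variable {ι : Type*} [Fintype ι]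

theorem expect_mono {a b : ι → ℝ} (h : ∀ i, a i ≤ b i) : 𝔼 i, a i ≤ 𝔼 i, b i :=
  Finset.expect_le_expect fun i _ => h i

theorem expect_nonneg {a : ι → ℝ} (h : ∀ i, 0 ≤ a i) : 0 ≤ 𝔼 i, a i :=
  Finset.expect_nonneg fun i _ => h i

theorem expect_le_of_le [Nonempty ι] {a : ι → ℝ} {C : ℝ} (h : ∀ i, a i ≤ C) : 𝔼 i, a i ≤ C :=
  Finset.expect_le Finset.univ_nonempty fun i _ => h i

theorem expect_perm (σ : Equiv.Perm ι) (a : ι → ℝ) : 𝔼 i, a (σ i) = 𝔼 i, a i :=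
  Fintype.expect_equiv σ _ _ fun _ => rfl

theorem abs_expect_sub_le [Nonempty ι] (a : ι → ℝ) (c : ℝ) :
    |𝔼 i, a i - c| ≤ 𝔼 i, |a i - c| := by
  have h : 𝔼 i, a i - c = 𝔼 i, (a i - c) := by
    rw [Finset.expect_sub_distrib, Fintype.expect_const]
  rw [h]
  exact Finset.abs_expect_le _ _

theorem sq_expect_le [Nonempty ι] (a : ι → ℝ) : (𝔼 i, a i) ^ 2 ≤ 𝔼 i, a i ^ 2 := by
  have h := Finset.expect_mul_sq_le_sq_mul_sq (R := ℝ) Finset.univ a fun _ => 1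
  simpa using h

/-- Markov's inequality for uniform averages. -/
theorem mul_ncard_le_expect {a : ι → ℝ} (ha : ∀ i, 0 ≤ a i) (ε : ℝ) :
    ε * (({i | ε ≤ a i}.ncard : ℝ) / (Fintype.card ι : ℝ)) ≤ 𝔼 i, a i := by
  classical
  rw [Fintype.expect_eq_sum_div_card, ← mul_div_assoc]
  gcongr
  have : ({i | ε ≤ a i} : Set ι) = ↑(Finset.univ.filter fun i => ε ≤ a i) := by ext; simp
  rw [this, Set.ncard_coe_finset, mul_comm, ← nsmul_eq_mul]
  calc _ ≤ ∑ i ∈ Finset.univ.filter (fun i => ε ≤ a i), a i :=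
        Finset.card_nsmul_le_sum _ _ _ fun i hi => (Finset.mem_filter.1 hi).2
    _ ≤ _ := Finset.sum_le_sum_of_subset_of_nonneg (Finset.subset_univ _) fun i _ _ => ha i

/-- The counterpart of Markov's inequality: at most `ε` off the exceptional set, at most `C` on it.
It turns high probability into convergence in mean. -/
theorem expect_le_add_ncard [Nonempty ι] {a : ι → ℝ} {C : ℝ} (ha : ∀ i, a i ≤ C)
    {ε : ℝ} (hε : 0 ≤ ε) :
    𝔼 i, a i ≤ ε + C * (({i | ¬ a i < ε}.ncard : ℝ) / (Fintype.card ι : ℝ)) := by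
  classical
  have : ({i | ¬ a i < ε} : Set ι) = ↑(Finset.univ.filter fun i => ¬ a i < ε) := by ext; simp
  rw [this, Set.ncard_coe_finset]
  have h1 : ∀ i, a i ≤ ε + C * (if ¬ a i < ε then 1 else 0) := by
    intro i
    by_cases h : a i < ε
    · simp [h, h.le]
    · simp only [h, not_false_eq_true, if_true, mul_one]; linarith [ha i]
  refine (expect_mono h1).trans_eq ?_
  rw [Finset.expect_add_distrib, Fintype.expect_const, ← Finset.mul_expect,
    Fintype.expect_eq_sum_div_card (fun i => if ¬ a i < ε then (1 : ℝ) else 0)]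
  simp

end Averages

theorem integrable_of_abs_le {Z : Type*} [MeasurableSpace Z] {m : Measure Z} [IsFiniteMeasure m]
    {f : Z → ℝ} (hf : Measurable f) {C : ℝ} (h : ∀ z, |f z| ≤ C) : Integrable f m :=
  Integrable.of_bound hf.aestronglyMeasurable C (Eventually.of_forall h)

theorem integral_expect {ι : Type*} [Fintype ι] {Z : Type*} [MeasurableSpace Z] {m : Measure Z}
    {f : ι → Z → ℝ} (hf : ∀ i, Integrable (f i) m) :
    ∫ z, 𝔼 i, f i z ∂m = 𝔼 i, ∫ z, f i z ∂m := by
  simp only [Fintype.expect_eq_sum_div_card]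
  rw [integral_div, integral_finsetSum _ fun i _ => hf i]

theorem abs_integral_le_of_abs_le {Z : Type*} [MeasurableSpace Z] {m : Measure Z}
    [IsProbabilityMeasure m] {f : Z → ℝ} {C : ℝ} (h : ∀ z, |f z| ≤ C) : |∫ z, f z ∂m| ≤ C := by
  simpa using norm_integral_le_of_norm_le_const (μ := m) (f := f)
    (Eventually.of_forall fun z => (Real.norm_eq_abs _).trans_le (h z))

/-! ### High probability over vertices, as a filter. -/

section HighProbability

variable {V : ℕ → Type} [∀ n, Fintype (V n)] [∀ n, Nonempty (V n)]

theorem ncard_compl_div (n : ℕ) (P : V n → Prop) :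
    ({v | ¬ P v}.ncard : ℝ) / (Fintype.card (V n) : ℝ) =
      1 - ({v | P v}.ncard : ℝ) / (Fintype.card (V n) : ℝ) := by
  have h := Set.ncard_add_ncard_compl {v | P v}
  have hc : (Fintype.card (V n) : ℝ) ≠ 0 := by exact_mod_cast Fintype.card_ne_zero
  rw [Nat.card_eq_fintype_card] at h
  rw [eq_sub_iff_add_eq, ← add_div, div_eq_one_iff_eq hc, ← h, add_comm]
  push_cast
  rfl

theorem whp_iff {P : ∀ n, V n → Prop} :
    WHP P ↔ Tendsto (fun n => ({v | ¬ P n v}.ncard : ℝ) / (Fintype.card (V n) : ℝ)) atTop (𝓝 0) := by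
  simp only [ncard_compl_div, WHP]
  constructor
  · intro h; simpa using h.const_sub 1
  · intro h; simpa using h.const_sub 1

variable (V) in
/-- The filter of sets of vertices which hold with high probability. -/
def vertexFilter : Filter (Σ n, V n) where
  sets := {A | WHP fun n v => (⟨n, v⟩ : Σ n, V n) ∈ A}
  univ_sets := by simp [whp_iff]
  sets_of_superset := by
    intro A B hA hAB
    rw [Set.mem_ofPred_eq, whp_iff] at hA ⊢
    refine squeeze_zero (fun n => by positivity) (fun n => ?_) hA
    gcongr ?_ / _
    refine Nat.cast_le.2 (Set.ncard_le_ncard fun v hv => ?_)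
    exact fun hvA => hv (hAB hvA)
  inter_sets := by
    intro A B hA hB
    rw [Set.mem_ofPred_eq, whp_iff] at hA hB ⊢
    refine squeeze_zero (fun n => by positivity) (fun n => ?_) (by simpa using hA.add hB)
    rw [← add_div]
    gcongr ?_ / _
    rw [← Nat.cast_add]
    refine Nat.cast_le.2 (le_trans (Set.ncard_le_ncard fun v hv => ?_) (Set.ncard_union_le _ _))
    by_contra h
    simp only [Set.mem_union, Set.mem_ofPred_eq, not_or, not_not] at h
    exact hv h

/-- Quenched convergence quantifies over neighbourhoods of `μ`. Expressing high probability by a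
filter makes it convergence along that filter, which for measures can be tested one continuous
function at a time; Markov's inequality then leaves only a mean error to estimate. -/
theorem tendsto_vertexFilter {a : ∀ n, V n → ℝ} {c : ℝ}
    (h : Tendsto (fun n => 𝔼 v, |a n v - c|) atTop (𝓝 0)) :
    Tendsto (fun p : Σ n, V n => a p.1 p.2) (vertexFilter V) (𝓝 c) := by
  rw [Metric.tendsto_nhds]
  intro ε hε
  change WHP _
  rw [whp_iff]
  refine squeeze_zero (fun n => by positivity) (fun n => ?_) (by simpa using h.const_mul ε⁻¹)
  have := mul_ncard_le_expect (a := fun v => |a n v - c|) (fun _ => abs_nonneg _) ε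
  rw [inv_mul_eq_div, le_div_iff₀' hε]
  simpa [Real.dist_eq] using this

theorem tendsto_expect_of_whp {a : ∀ n, V n → ℝ} {C : ℝ} (hC : ∀ n v, a n v ≤ C)
    (h0 : ∀ n v, 0 ≤ a n v) (h : ∀ ε > 0, WHP fun n v => a n v < ε) : Tendsto (fun n => 𝔼 v, a n v) atTop (𝓝 0) := by
  rw [Metric.tendsto_nhds]
  intro ε hε
  have h1 := whp_iff.1 (h (ε / 2) (by positivity))
  have h2 := (h1.const_mul C).const_add (ε / 2)
  rw [mul_zero, add_zero] at h2
  filter_upwards [h2.eventually_lt_const (half_lt_self hε)] with n hn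
  rw [Real.dist_eq, sub_zero, abs_of_nonneg (expect_nonneg (h0 n))]
  exact (expect_le_add_ncard (hC n) (by positivity)).trans_lt hn

end HighProbability

/-! ### High probability over models, as a filter. -/

section ModelFilter

variable {Z : ℕ → Type*} [∀ n, MeasurableSpace (Z n)]

/-- The filter of sets whose complements have asymptotically vanishing measure. -/
def modelFilter (m : ∀ n, ProbabilityMeasure (Z n)) : Filter (Σ n, Z n) where
  sets := {A | Tendsto (fun n => (m n : Measure (Z n)) {z | (⟨n, z⟩ : Σ n, Z n) ∉ A}) atTop (𝓝 0)}
  univ_sets := by simp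
  sets_of_superset := by
    intro A B hA hAB
    exact tendsto_of_tendsto_of_tendsto_of_le_of_le tendsto_const_nhds hA (fun n => zero_le)
      fun n => measure_mono fun z hz hzA => hz (hAB hzA)
  inter_sets := by
    intro A B hA hB
    refine tendsto_of_tendsto_of_tendsto_of_le_of_le tendsto_const_nhds
      (by simpa using Tendsto.add hA hB) (fun n => zero_le)
      fun n => le_trans (measure_mono fun z hz => ?_) (measure_union_le _ _)
    by_contra h
    simp only [Set.mem_union, Set.mem_ofPred_eq, not_or, not_not] at h
    exact hz h

variable {m : ∀ n, ProbabilityMeasure (Z n)}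

/-- Sets of models are not assumed measurable. The filter is therefore defined by small outer
measure of complements, which is stable under intersections, and subadditivity recovers full measure
in the limit. -/
theorem tendsto_measure_of_mem_modelFilter {A : Set (Σ n, Z n)} (hA : A ∈ modelFilter m) :
    Tendsto (fun n => (m n : Measure (Z n)) {z | (⟨n, z⟩ : Σ n, Z n) ∈ A}) atTop (𝓝 1) := by
  have hA : Tendsto (fun n => (m n : Measure (Z n)) {z | (⟨n, z⟩ : Σ n, Z n) ∉ A}) atTop (𝓝 0) := hA
  have h1 : Tendsto (fun n => 1 - (m n : Measure (Z n)) {z | (⟨n, z⟩ : Σ n, Z n) ∉ A})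
      atTop (𝓝 1) := by
    simpa using ENNReal.Tendsto.sub (tendsto_const_nhds (x := (1 : ℝ≥0∞))) hA (Or.inl (by simp))
  refine tendsto_of_tendsto_of_tendsto_of_le_of_le h1 tendsto_const_nhds (fun n => ?_)
    fun n => prob_le_one
  refine tsub_le_iff_right.2 ?_
  rw [← measure_univ (μ := (m n : Measure (Z n)))]
  refine le_trans (measure_mono fun z _ => ?_) (measure_union_le _ _)
  exact em _

theorem tendsto_modelFilter {a : ∀ n, Z n → ℝ} {c C : ℝ} (ha : ∀ n, Measurable (a n))
    (hC : ∀ n z, |a n z| ≤ C)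
    (h : Tendsto (fun n => ∫ z, |a n z - c| ∂(m n : Measure (Z n))) atTop (𝓝 0)) :
    Tendsto (fun p : Σ n, Z n => a p.1 p.2) (modelFilter m) (𝓝 c) := by
  rw [Metric.tendsto_nhds]
  intro ε hε
  change Tendsto _ _ _
  rw [← ENNReal.tendsto_toReal_iff (fun n => measure_ne_top _ _) (by simp)]
  refine squeeze_zero (fun n => by positivity) (fun n => ?_) (by simpa using h.const_mul ε⁻¹)
  have hi : Integrable (fun z => |a n z - c|) (m n : Measure (Z n)) :=
    ((integrable_of_abs_le (ha n) (hC n)).sub (integrable_const c)).abs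
  have := mul_meas_ge_le_integral_of_nonneg (Eventually.of_forall fun z => abs_nonneg (a n z - c)) hi ε
  rw [inv_mul_eq_div, le_div_iff₀' hε]
  simpa [Real.dist_eq, Measure.real] using this

theorem integral_le_add_measure {Y : Type*} [MeasurableSpace Y] (ν : Measure Y)
    [IsProbabilityMeasure ν] {a : Y → ℝ} {C ε : ℝ} (ha : Measurable a)
    (hC : ∀ z, a z ≤ C) (h0 : ∀ z, 0 ≤ a z) (hε : 0 ≤ ε) :
    ∫ z, a z ∂ν ≤ ε + C * (1 - ν.real {z | a z < ε}) := by
  have hs : MeasurableSet {z | a z < ε} := measurableSet_lt ha measurable_const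
  have hi : Integrable a ν := integrable_of_abs_le ha fun z => by rw [abs_of_nonneg (h0 z)]; exact hC z
  rw [← probReal_compl_eq_one_sub hs]
  have h1 : ∀ z, a z ≤ ε + {z | a z < ε}ᶜ.indicator (fun _ => C) z := by
    intro z
    by_cases h : a z < ε
    · simp [h, h.le]
    · simp [h]; linarith [hC z]
  refine (integral_mono hi ((integrable_const _).add ((integrable_const _).indicator hs.compl)) h1).trans_eq ?_
  simp only [Pi.add_apply]
  rw [integral_add (integrable_const _) ((integrable_const _).indicator hs.compl),
    integral_indicator_const _ hs.compl]
  simp [mul_comm]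

theorem tendsto_integral_of_whp {a : ∀ n, Z n → ℝ} {C : ℝ} (ha : ∀ n, Measurable (a n))
    (hC : ∀ n z, a n z ≤ C) (h0 : ∀ n z, 0 ≤ a n z)
    (h : ∀ ε > 0, Tendsto (fun n => (m n : Measure (Z n)) {z | a n z < ε}) atTop (𝓝 1)) :
    Tendsto (fun n => ∫ z, a n z ∂(m n : Measure (Z n))) atTop (𝓝 0) := by
  rw [Metric.tendsto_nhds]
  intro ε hε
  have h1 := h (ε / 2) (by positivity)
  rw [← ENNReal.tendsto_toReal_iff (fun n => measure_ne_top _ _) (by simp)] at h1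
  have h2 := ((h1.const_sub 1).const_mul C).const_add (ε / 2)
  simp only [ENNReal.toReal_one, sub_self, mul_zero, add_zero] at h2
  filter_upwards [h2.eventually_lt_const (half_lt_self hε)] with n hn
  rw [Real.dist_eq, sub_zero, abs_of_nonneg (integral_nonneg (h0 n))]
  exact (integral_le_add_measure _ (ha n) (hC n) (h0 n) (by positivity)).trans_lt hn

end ModelFilter

/-! ### Quenched convergence through continuous test functions. -/

section TestFunctions

variable {G : Type*} [Group G] {X : Type*} [TopologicalSpace X] [CompactSpace X] [MeasurableSpace X]

/-- The average over vertices of the error in the local means of `f`. -/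
noncomputable def localDeviation (S : SoficApproximation G)
    (m : ∀ n, ProbabilityMeasure (S.V n → X)) (μ : ProbabilityMeasure (G → X))
    (f : C(G → X, ℝ)) (n : ℕ) : ℝ :=
  𝔼 v, |∫ x, f (pullbackName (S.σ n) v x) ∂(m n : Measure (S.V n → X)) - ∫ y, f y ∂(μ : Measure (G → X))|

/-- The mean error of the empirical average of `f`. -/
noncomputable def empiricalDeviation (S : SoficApproximation G)
    (m : ∀ n, ProbabilityMeasure (S.V n → X)) (μ : ProbabilityMeasure (G → X))
    (f : C(G → X, ℝ)) (n : ℕ) : ℝ :=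
  ∫ x, |𝔼 v, f (pullbackName (S.σ n) v x) - ∫ y, f y ∂(μ : Measure (G → X))|
    ∂(m n : Measure (S.V n → X))

/-- The average over pairs of vertices of the failure of decorrelation of `f` and `g`. -/
noncomputable def pairDeviation (S : SoficApproximation G)
    (m : ∀ n, ProbabilityMeasure (S.V n → X)) (μ : ProbabilityMeasure (G → X))
    (f g : C(G → X, ℝ)) (n : ℕ) : ℝ :=
  𝔼 v, 𝔼 w, |∫ x, f (pullbackName (S.σ n) v x) * g (pullbackName (S.σ n) w x)
    ∂(m n : Measure (S.V n → X)) -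
      (∫ y, f y ∂(μ : Measure (G → X))) * ∫ y, g y ∂(μ : Measure (G → X))|

theorem pairDeviation_nonneg (S : SoficApproximation G) (m : ∀ n, ProbabilityMeasure (S.V n → X))
    (μ : ProbabilityMeasure (G → X)) (f g : C(G → X, ℝ)) (n : ℕ) :
    0 ≤ pairDeviation S m μ f g n :=
  expect_nonneg fun _ => expect_nonneg fun _ => abs_nonneg _

theorem localDeviation_nonneg (S : SoficApproximation G) (m : ∀ n, ProbabilityMeasure (S.V n → X))
    (μ : ProbabilityMeasure (G → X)) (f : C(G → X, ℝ)) (n : ℕ) :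
    0 ≤ localDeviation S m μ f n :=
  expect_nonneg fun _ => abs_nonneg _

theorem empiricalDeviation_nonneg (S : SoficApproximation G)
    (m : ∀ n, ProbabilityMeasure (S.V n → X)) (μ : ProbabilityMeasure (G → X))
    (f : C(G → X, ℝ)) (n : ℕ) : 0 ≤ empiricalDeviation S m μ f n :=
  integral_nonneg fun _ => abs_nonneg _

/-- Thus decorrelation on a family containing `1` includes the convergence of local means. -/
theorem pairDeviation_one (S : SoficApproximation G) (m : ∀ n, ProbabilityMeasure (S.V n → X))
    (μ : ProbabilityMeasure (G → X)) (f : C(G → X, ℝ)) (n : ℕ) :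
    pairDeviation S m μ f 1 n = localDeviation S m μ f n := by
  simp [pairDeviation, localDeviation]

theorem abs_apply_le_norm {Z : Type*} [TopologicalSpace Z] [CompactSpace Z] (f : C(Z, ℝ)) (z : Z) :
    |f z| ≤ ‖f‖ :=
  f.norm_coe_le_norm z

variable [Countable G] [SecondCountableTopology X] [BorelSpace X]

theorem measurable_apply_pullbackName {V : Type} (f : C(G → X, ℝ)) (σ : G → Equiv.Perm V) (v : V) :
    Measurable fun x : V → X => f (pullbackName σ v x) :=
  f.continuous.measurable.comp (measurable_pullbackName σ v)

theorem integrable_apply {Z : Type*} [TopologicalSpace Z] [CompactSpace Z] [MeasurableSpace Z]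
    [OpensMeasurableSpace Z] (ν : Measure Z) [IsFiniteMeasure ν] (f : C(Z, ℝ)) : Integrable f ν :=
  integrable_of_abs_le f.continuous.measurable (abs_apply_le_norm f)

theorem integrable_apply_pullbackName {V : Type} (f : C(G → X, ℝ)) (σ : G → Equiv.Perm V) (v : V)
    (m : Measure (V → X)) [IsFiniteMeasure m] :
    Integrable (fun x : V → X => f (pullbackName σ v x)) m :=
  integrable_of_abs_le (measurable_apply_pullbackName f σ v) fun _ => abs_apply_le_norm f _

theorem integrable_mul_pullbackName {V : Type} (f g : C(G → X, ℝ)) (σ : G → Equiv.Perm V)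
    (v w : V) (m : Measure (V → X)) [IsFiniteMeasure m] :
    Integrable (fun x : V → X => f (pullbackName σ v x) * g (pullbackName σ w x)) m :=
  integrable_of_abs_le
    ((measurable_apply_pullbackName f σ v).mul (measurable_apply_pullbackName g σ w))
    (C := ‖f‖ * ‖g‖) fun _ => by
      rw [abs_mul]
      exact mul_le_mul (abs_apply_le_norm f _) (abs_apply_le_norm g _) (abs_nonneg _) (norm_nonneg _)

theorem measurable_expect_pullbackName {V : Type} [Fintype V] (f : C(G → X, ℝ))
    (σ : G → Equiv.Perm V) : Measurable fun x : V → X => 𝔼 v, f (pullbackName σ v x) := by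
  simp only [Fintype.expect_eq_sum_div_card]
  exact (Finset.measurable_sum _ fun v _ => measurable_apply_pullbackName f σ v).div_const _

theorem abs_expect_pullbackName_le {V : Type} [Fintype V] [Nonempty V] (f : C(G → X, ℝ))
    (σ : G → Equiv.Perm V) (x : V → X) : |𝔼 v, f (pullbackName σ v x)| ≤ ‖f‖ :=
  (Finset.abs_expect_le _ _).trans (expect_le_of_le fun _ => abs_apply_le_norm f _)

theorem integral_empirical {V : Type} [Fintype V] [Nonempty V] (f : C(G → X, ℝ))
    (σ : G → Equiv.Perm V) (x : V → X) :
    ∫ y, f y ∂(empirical σ x : Measure (G → X)) = 𝔼 v, f (pullbackName σ v x) := by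
  change ∫ y, f y ∂((Fintype.card V : ℝ≥0∞)⁻¹ • ∑ v : V, Measure.dirac (pullbackName σ v x)) = _
  rw [integral_smul_measure, integral_finsetSum_measure fun v _ => integrable_apply _ f,
    Fintype.expect_eq_sum_div_card, div_eq_inv_mul]
  simp [integral_dirac' _ _ f.continuous.measurable.stronglyMeasurable]

theorem integral_map_pullbackName {V : Type} (f : C(G → X, ℝ)) (σ : G → Equiv.Perm V) (v : V)
    (m : ProbabilityMeasure (V → X)) :
    ∫ y, f y ∂(m.map (measurable_pullbackName σ v).aemeasurable : Measure (G → X)) =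
      ∫ x, f (pullbackName σ v x) ∂(m : Measure (V → X)) := by
  rw [ProbabilityMeasure.toMeasure_map, integral_map (measurable_pullbackName σ v).aemeasurable
    f.continuous.measurable.aestronglyMeasurable]

theorem setOf_abs_integral_sub_lt_mem_nhds (μ : ProbabilityMeasure (G → X)) (f : C(G → X, ℝ))
    {ε : ℝ} (hε : 0 < ε) :
    {ν : ProbabilityMeasure (G → X) |
      |∫ y, f y ∂(ν : Measure (G → X)) - ∫ y, f y ∂(μ : Measure (G → X))| < ε} ∈ 𝓝 μ := by
  have h := ProbabilityMeasure.tendsto_iff_forall_integral_tendsto.1 (tendsto_id (x := 𝓝 μ))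
    (BoundedContinuousFunction.mkOfCompact f)
  exact Metric.tendsto_nhds.1 h ε hε

variable {S : SoficApproximation G} {m : ∀ n, ProbabilityMeasure (S.V n → X)}
  {μ : ProbabilityMeasure (G → X)}

theorem QuenchedConverges.tendsto_localDeviation (h : QuenchedConverges S m μ) (f : C(G → X, ℝ)) :
    Tendsto (localDeviation S m μ f) atTop (𝓝 0) := by
  refine tendsto_expect_of_whp (C := ‖f‖ + ‖f‖) (fun n v => ?_) (fun n v => abs_nonneg _)
    fun ε hε => ?_
  · exact (abs_sub _ _).trans (add_le_add (abs_integral_le_of_abs_le fun _ => abs_apply_le_norm f _)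
      (abs_integral_le_of_abs_le fun _ => abs_apply_le_norm f _))
  · simpa only [Set.mem_ofPred_eq, integral_map_pullbackName] using
      h.1 _ (setOf_abs_integral_sub_lt_mem_nhds μ f hε)

theorem QuenchedConverges.tendsto_empiricalDeviation (h : QuenchedConverges S m μ)
    (f : C(G → X, ℝ)) : Tendsto (empiricalDeviation S m μ f) atTop (𝓝 0) := by
  refine tendsto_integral_of_whp (C := ‖f‖ + ‖f‖) (fun n => ?_) (fun n x => ?_)
    (fun n v => abs_nonneg _) fun ε hε => ?_
  · exact ((measurable_expect_pullbackName f _).sub_const _).abs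
  · exact (abs_sub _ _).trans (add_le_add (abs_expect_pullbackName_le f _ _)
      (abs_integral_le_of_abs_le fun _ => abs_apply_le_norm f _))
  · simpa only [goodModels, Set.mem_ofPred_eq, integral_empirical] using
      h.2 _ (setOf_abs_integral_sub_lt_mem_nhds μ f hε)

theorem quenchedConverges_of_tendsto
    (h1 : ∀ f : C(G → X, ℝ), Tendsto (localDeviation S m μ f) atTop (𝓝 0))
    (h2 : ∀ f : C(G → X, ℝ), Tendsto (empiricalDeviation S m μ f) atTop (𝓝 0)) :
    QuenchedConverges S m μ := by
  constructor
  · have h : Tendsto (fun p : Σ n, S.V n =>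
        (m p.1).map (measurable_pullbackName (S.σ p.1) p.2).aemeasurable)
        (vertexFilter S.V) (𝓝 μ) := by
      rw [ProbabilityMeasure.tendsto_iff_forall_integral_tendsto]
      intro f
      have := tendsto_vertexFilter (h1 f.toContinuousMap)
      exact this.congr fun p =>
        (integral_map_pullbackName f.toContinuousMap (S.σ p.1) p.2 (m p.1)).symm
    intro O hO
    exact h hO
  · have h : Tendsto (fun p : Σ n, S.V n → X => empirical (S.σ p.1) p.2)
        (modelFilter m) (𝓝 μ) := by
      rw [ProbabilityMeasure.tendsto_iff_forall_integral_tendsto]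
      intro f
      have := tendsto_modelFilter (fun n => measurable_expect_pullbackName f.toContinuousMap (S.σ n))
        (fun n => abs_expect_pullbackName_le f.toContinuousMap (S.σ n)) (h2 f.toContinuousMap)
      exact this.congr fun p => (integral_empirical f.toContinuousMap (S.σ p.1) p.2).symm
    intro O hO
    exact tendsto_measure_of_mem_modelFilter (h hO)

end TestFunctions

/-- A uniformly bounded sequence of seminorms which tends to zero pointwise on a set tends to zero
pointwise on its closed linear span. -/
theorem tendsto_zero_of_mem_closure_span {E : Type*} [NormedAddCommGroup E] [NormedSpace ℝ E]
    {N : ℕ → E → ℝ} {C : ℝ} (h0 : ∀ n f, 0 ≤ N n f) (hadd : ∀ n f g, N n (f + g) ≤ N n f + N n g)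
    (hsmul : ∀ n (c : ℝ) f, N n (c • f) ≤ |c| * N n f) (hb : ∀ n f, N n f ≤ C * ‖f‖) {T : Set E}
    (hT : ∀ f ∈ T, Tendsto (fun n => N n f) atTop (𝓝 0)) {f : E}
    (hf : f ∈ closure (Submodule.span ℝ T : Set E)) : Tendsto (fun n => N n f) atTop (𝓝 0) := by
  have hs : ∀ f ∈ Submodule.span ℝ T, Tendsto (fun n => N n f) atTop (𝓝 0) := by
    intro f hf
    induction hf using Submodule.span_induction with
    | mem f hf => exact hT f hf
    | zero => exact squeeze_zero (fun n => h0 n 0) (fun n => by simpa using hb n 0) tendsto_const_nhds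
    | add f g _ _ hf hg =>
      exact squeeze_zero (fun n => h0 n _) (fun n => hadd n f g) (by simpa using hf.add hg)
    | smul c f _ hf =>
      exact squeeze_zero (fun n => h0 n _) (fun n => hsmul n c f) (by simpa using hf.const_mul |c|)
  rw [Metric.tendsto_nhds]
  intro ε hε
  -- `|C| + 1` is used because the sign of `C` is unknown; it makes the seminorm of `f - g` less
  -- than `ε / 2`.
  obtain ⟨g, hg, hfg⟩ := Metric.mem_closure_iff.1 hf (ε / (2 * (|C| + 1))) (by positivity)
  filter_upwards [(hs g hg).eventually_lt_const (half_pos hε)] with n hn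
  rw [Real.dist_eq, sub_zero, abs_of_nonneg (h0 _ _)]
  have h1 : N n f ≤ N n (f - g) + N n g := by simpa using hadd n (f - g) g
  have h2 : N n (f - g) ≤ (|C| + 1) * ‖f - g‖ :=
    (hb _ _).trans (by gcongr; linarith [le_abs_self C])
  rw [dist_eq_norm, lt_div_iff₀' (by positivity)] at hfg
  linarith

/-- Stone-Weierstrass: the linear span of a family closed under products is already the algebra it
generates. -/
theorem closure_span_eq_univ_of_separates {Z : Type*} [TopologicalSpace Z] [CompactSpace Z]
    (T : Submonoid C(Z, ℝ)) (hT : ∀ x y : Z, x ≠ y → ∃ f ∈ T, f x ≠ f y) :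
    closure (Submodule.span ℝ (T : Set C(Z, ℝ)) : Set C(Z, ℝ)) = Set.univ := by
  have h := ContinuousMap.subalgebra_topologicalClosure_eq_top_of_separatesPoints
    (Algebra.adjoin ℝ (T : Set C(Z, ℝ))) (by
      intro x y hxy
      obtain ⟨f, hf, hne⟩ := hT x y hxy
      exact ⟨f, ⟨f, Algebra.subset_adjoin hf, rfl⟩, hne⟩)
  have h2 := Algebra.adjoin_eq_span ℝ (T : Set C(Z, ℝ))
  rw [Submonoid.closure_eq] at h2
  rw [← h2]
  have h3 := congrArg (fun A : Subalgebra ℝ C(Z, ℝ) => (A : Set C(Z, ℝ))) h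
  simpa using h3

theorem integral_sub_mul_add {Z : Type*} [MeasurableSpace Z] {m : Measure Z} [IsProbabilityMeasure m]
    {u w : Z → ℝ} (hu : Integrable u m) (hw : Integrable w m) (b c : ℝ) :
    ∫ z, (u z - b * w z + c) ∂m = ∫ z, u z ∂m - b * ∫ z, w z ∂m + c := by
  have h : Integrable (fun z => u z - b * w z) m := hu.sub (hw.const_mul b)
  rw [integral_add h (integrable_const _), integral_sub hu (hw.const_mul b), integral_const_mul]
  simp

/-- Expand `∫ (|f| - a)² ≥ 0`, where `a` is the mean of `|f|`. -/
theorem sq_integral_abs_le {Z : Type*} [MeasurableSpace Z] {m : Measure Z} [IsProbabilityMeasure m]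
    {f : Z → ℝ} (hf : Measurable f) {C : ℝ} (h : ∀ z, |f z| ≤ C) :
    (∫ z, |f z| ∂m) ^ 2 ≤ ∫ z, f z ^ 2 ∂m := by
  set a := ∫ z, |f z| ∂m with ha
  have h1 : Integrable (fun z => |f z|) m := (integrable_of_abs_le hf h).abs
  have h2 : Integrable (fun z => f z ^ 2) m := integrable_of_abs_le (hf.pow_const 2) (C := C ^ 2)
    fun z => by rw [abs_pow]; exact pow_le_pow_left₀ (abs_nonneg _) (h z) 2
  have h3 : 0 ≤ ∫ z, (f z ^ 2 - 2 * a * |f z| + a ^ 2) ∂m :=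
    integral_nonneg fun z => by
      have := sq_nonneg (|f z| - a)
      simp only [Pi.zero_apply]
      nlinarith [sq_abs (f z)]
  rw [integral_sub_mul_add h2 h1, ← ha] at h3
  nlinarith

/-! ### From decorrelation to quenched convergence. -/

section Quenched

variable {G : Type*} [Group G] [Countable G] {X : Type*} [TopologicalSpace X] [CompactSpace X]
  [MeasurableSpace X] [SecondCountableTopology X] [BorelSpace X]

/-- The second-moment method. Expanding the square of the empirical average into a double average
over vertices, its second moment about `c` is the mean error of the pair correlations minus `2c`
times the mean error of the local means. -/
theorem sq_empiricalDeviation_le (S : SoficApproximation G)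
    (m : ∀ n, ProbabilityMeasure (S.V n → X)) (μ : ProbabilityMeasure (G → X))
    (f : C(G → X, ℝ)) (n : ℕ) :
    empiricalDeviation S m μ f n ^ 2 ≤
      pairDeviation S m μ f f n + 2 * ‖f‖ * localDeviation S m μ f n := by
  set c := ∫ y, f y ∂(μ : Measure (G → X)) with hc
  have hcf : |c| ≤ ‖f‖ := abs_integral_le_of_abs_le fun _ => abs_apply_le_norm f _
  have hm := measurable_expect_pullbackName f (S.σ n)
  have h1 : empiricalDeviation S m μ f n ^ 2 ≤
      ∫ x, (𝔼 v, f (pullbackName (S.σ n) v x) - c) ^ 2 ∂(m n : Measure (S.V n → X)) :=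
    sq_integral_abs_le (hm.sub_const c) (C := ‖f‖ + ‖f‖) fun x =>
      (abs_sub _ _).trans (add_le_add (abs_expect_pullbackName_le f _ _) hcf)
  have i1 : Integrable (fun x => 𝔼 v, f (pullbackName (S.σ n) v x)) (m n : Measure (S.V n → X)) :=
    integrable_of_abs_le hm (abs_expect_pullbackName_le f _)
  have i2 : Integrable (fun x => (𝔼 v, f (pullbackName (S.σ n) v x)) ^ 2)
      (m n : Measure (S.V n → X)) :=
    integrable_of_abs_le (hm.pow_const 2) (C := ‖f‖ ^ 2) fun x => by
      rw [abs_pow]; exact pow_le_pow_left₀ (abs_nonneg _) (abs_expect_pullbackName_le f _ x) 2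
  have e1 : ∫ x, 𝔼 v, f (pullbackName (S.σ n) v x) ∂(m n : Measure (S.V n → X)) =
      𝔼 v, ∫ x, f (pullbackName (S.σ n) v x) ∂(m n : Measure (S.V n → X)) :=
    integral_expect fun v => integrable_apply_pullbackName f _ v _
  have e2 : ∫ x, (𝔼 v, f (pullbackName (S.σ n) v x)) ^ 2 ∂(m n : Measure (S.V n → X)) =
      𝔼 p : S.V n × S.V n, ∫ x, f (pullbackName (S.σ n) p.1 x) * f (pullbackName (S.σ n) p.2 x)
        ∂(m n : Measure (S.V n → X)) := by
    rw [← integral_expect fun p : S.V n × S.V n =>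
      integrable_mul_pullbackName f f (S.σ n) p.1 p.2 (m n : Measure (S.V n → X))]
    congr 1
    ext x
    rw [sq, Fintype.expect_mul_expect, ← Finset.univ_product_univ, Finset.expect_product]
  have e3 : pairDeviation S m μ f f n = 𝔼 p : S.V n × S.V n,
      |∫ x, f (pullbackName (S.σ n) p.1 x) * f (pullbackName (S.σ n) p.2 x)
        ∂(m n : Measure (S.V n → X)) - c * c| := by
    rw [← Finset.univ_product_univ, Finset.expect_product]; rfl
  have e4 : ∫ x, (𝔼 v, f (pullbackName (S.σ n) v x) - c) ^ 2 ∂(m n : Measure (S.V n → X)) =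
      (∫ x, (𝔼 v, f (pullbackName (S.σ n) v x)) ^ 2 ∂(m n : Measure (S.V n → X)) - c * c) -
      2 * c * (∫ x, 𝔼 v, f (pullbackName (S.σ n) v x) ∂(m n : Measure (S.V n → X)) - c) := by
    have : ∀ x, (𝔼 v, f (pullbackName (S.σ n) v x) - c) ^ 2 =
        (𝔼 v, f (pullbackName (S.σ n) v x)) ^ 2 -
          2 * c * 𝔼 v, f (pullbackName (S.σ n) v x) + c ^ 2 := fun x => by ring
    simp only [this]
    rw [integral_sub_mul_add i2 i1]
    ring
  rw [e4, e1, e2] at h1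
  refine h1.trans ?_
  rw [sub_eq_add_neg]
  refine add_le_add ?_ ?_
  · rw [e3]
    exact (le_abs_self _).trans (abs_expect_sub_le _ _)
  · refine (neg_le_abs _).trans ?_
    rw [abs_mul, abs_mul, abs_two]
    gcongr
    exact abs_expect_sub_le _ _

variable {S : SoficApproximation G} {m : ∀ n, ProbabilityMeasure (S.V n → X)}
  {μ : ProbabilityMeasure (G → X)}

theorem tendsto_empiricalDeviation {f : C(G → X, ℝ)}
    (h1 : Tendsto (localDeviation S m μ f) atTop (𝓝 0))
    (h2 : Tendsto (pairDeviation S m μ f f) atTop (𝓝 0)) :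
    Tendsto (empiricalDeviation S m μ f) atTop (𝓝 0) := by
  have h3 : Tendsto (fun n => empiricalDeviation S m μ f n ^ 2) atTop (𝓝 0) :=
    squeeze_zero (fun n => sq_nonneg _) (sq_empiricalDeviation_le S m μ f)
      (by simpa using h2.add (h1.const_mul (2 * ‖f‖)))
  have h4 := h3.sqrt
  simpa [Real.sqrt_sq (empiricalDeviation_nonneg S m μ f _)] using h4

/-- On `T` the empirical deviation is controlled by decorrelation of `f` with itself. The local and
empirical deviations are seminorms in `f` bounded by `2‖f‖`, so their convergence extends to the
closed span of `T`, which is everything. -/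
theorem quenchedConverges_of_submonoid (T : Submonoid C(G → X, ℝ))
    (hT : ∀ x y : G → X, x ≠ y → ∃ f ∈ T, f x ≠ f y)
    (h : ∀ f ∈ T, ∀ g ∈ T, Tendsto (pairDeviation S m μ f g) atTop (𝓝 0)) :
    QuenchedConverges S m μ := by
  have hd := closure_span_eq_univ_of_separates T hT
  have hl : ∀ f ∈ T, Tendsto (localDeviation S m μ f) atTop (𝓝 0) := fun f hf =>
    (h f hf 1 T.one_mem).congr fun n => pairDeviation_one S m μ f n
  refine quenchedConverges_of_tendsto (fun f => ?_) (fun f => ?_)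
  · refine tendsto_zero_of_mem_closure_span (N := fun n f => localDeviation S m μ f n) (C := 2)
      (T := (T : Set C(G → X, ℝ))) (fun n f => localDeviation_nonneg S m μ f n) (fun n f g => ?_)
      (fun n c f => ?_) (fun n f => ?_) hl (hd ▸ Set.mem_univ f)
    · simp only [localDeviation]
      rw [← Finset.expect_add_distrib]
      refine expect_mono fun v => ?_
      simp only [ContinuousMap.add_apply]
      rw [integral_add (integrable_apply_pullbackName f _ v _) (integrable_apply_pullbackName g _ v _),
        integral_add (integrable_apply _ f) (integrable_apply _ g), add_sub_add_comm]
      exact abs_add_le _ _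
    · simp only [localDeviation]
      rw [Finset.mul_expect]
      refine expect_mono fun v => ?_
      simp only [ContinuousMap.smul_apply, smul_eq_mul]
      rw [integral_const_mul, integral_const_mul, ← mul_sub, abs_mul]
    · refine expect_le_of_le fun v => (abs_sub _ _).trans ?_
      rw [two_mul]
      exact add_le_add (abs_integral_le_of_abs_le fun _ => abs_apply_le_norm f _)
        (abs_integral_le_of_abs_le fun _ => abs_apply_le_norm f _)
  · have hi : ∀ n (f : C(G → X, ℝ)), Integrable (fun x =>
        𝔼 v, f (pullbackName (S.σ n) v x) - ∫ y, f y ∂(μ : Measure (G → X)))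
          (m n : Measure (S.V n → X)) := fun n f =>
      (integrable_of_abs_le (measurable_expect_pullbackName f _)
        (abs_expect_pullbackName_le f _)).sub (integrable_const _)
    refine tendsto_zero_of_mem_closure_span (N := fun n f => empiricalDeviation S m μ f n) (C := 2)
      (T := (T : Set C(G → X, ℝ))) (fun n f => empiricalDeviation_nonneg S m μ f n) (fun n f g => ?_)
      (fun n c f => ?_) (fun n f => ?_)
      (fun f hf => tendsto_empiricalDeviation (hl f hf) (h f hf f hf)) (hd ▸ Set.mem_univ f)
    · simp only [empiricalDeviation]
      rw [← integral_add (hi n f).abs (hi n g).abs]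
      refine integral_mono (hi n (f + g)).abs ((hi n f).abs.add (hi n g).abs) fun x => ?_
      simp only [ContinuousMap.add_apply, Finset.expect_add_distrib]
      rw [integral_add (integrable_apply _ f) (integrable_apply _ g), add_sub_add_comm]
      exact abs_add_le _ _
    · simp only [empiricalDeviation]
      rw [← integral_const_mul]
      refine integral_mono (hi n (c • f)).abs ((hi n f).abs.const_mul _) fun x => ?_
      simp only [ContinuousMap.smul_apply, smul_eq_mul, ← Finset.mul_expect]
      rw [integral_const_mul, ← mul_sub, abs_mul]
    · refine (le_abs_self _).trans (abs_integral_le_of_abs_le fun x => ?_)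
      rw [abs_abs, two_mul]
      exact (abs_sub _ _).trans (add_le_add (abs_expect_pullbackName_le f _ _)
        (abs_integral_le_of_abs_le fun _ => abs_apply_le_norm f _))

end Quenched

/-! ### Doubly-quenched convergence as asymptotic decorrelation. -/

section Square

variable {G : Type*} [Group G] {X : Type*} [TopologicalSpace X]

/-- The function `f ⊗ g` on `(X × X)^G`. -/
def tensor (f g : C(G → X, ℝ)) : C(G → X × X, ℝ) where
  toFun p := f (fun i => (p i).1) * g (fun i => (p i).2)
  continuous_toFun := by fun_prop

theorem tensor_apply (f g : C(G → X, ℝ)) (p : G → X × X) :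
    tensor f g p = f (fun i => (p i).1) * g (fun i => (p i).2) := rfl

theorem tensor_one_one : tensor (1 : C(G → X, ℝ)) 1 = 1 := by
  ext p; simp [tensor_apply]

theorem tensor_mul (f g f' g' : C(G → X, ℝ)) :
    tensor f g * tensor f' g' = tensor (f * f') (g * g') := by
  ext p; simp [tensor_apply]; ring

variable [CompactSpace X] [MeasurableSpace X] [Countable G] [SecondCountableTopology X] [BorelSpace X]

theorem integral_square {I : Type*} {m : ProbabilityMeasure (I → X)} {F : (I → X × X) → ℝ}
    (hF : Measurable F) :
    ∫ p, F p ∂(square m : Measure (I → X × X)) =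
      ∫ q, F (zipFun q) ∂((m : Measure (I → X)).prod (m : Measure (I → X))) := by
  rw [square, ProbabilityMeasure.toMeasure_map,
    integral_map measurable_zipFun.aemeasurable hF.aestronglyMeasurable,
    ProbabilityMeasure.toMeasure_prod]

theorem integral_tensor_square (μ : ProbabilityMeasure (G → X)) (f g : C(G → X, ℝ)) :
    ∫ p, tensor f g p ∂(square μ : Measure (G → X × X)) =
      (∫ y, f y ∂(μ : Measure (G → X))) * ∫ y, g y ∂(μ : Measure (G → X)) := by
  rw [integral_square (tensor f g).continuous.measurable, ← integral_prod_mul]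
  rfl

theorem integral_tensor_pullbackName {V : Type} (m : ProbabilityMeasure (V → X))
    (σ : G → Equiv.Perm V) (f g : C(G → X, ℝ)) (v : V) :
    ∫ p, tensor f g (pullbackName σ v p) ∂(square m : Measure (V → X × X)) =
      (∫ x, f (pullbackName σ v x) ∂(m : Measure (V → X))) *
        ∫ x, g (pullbackName σ v x) ∂(m : Measure (V → X)) := by
  rw [integral_square (measurable_apply_pullbackName _ σ v), ← integral_prod_mul]
  rfl

theorem integral_tensor_mul_pullbackName {V : Type} (m : ProbabilityMeasure (V → X))
    (σ : G → Equiv.Perm V) (f g f' g' : C(G → X, ℝ)) (v w : V) :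
    ∫ p, tensor f g (pullbackName σ v p) * tensor f' g' (pullbackName σ w p)
        ∂(square m : Measure (V → X × X)) =
      (∫ x, f (pullbackName σ v x) * f' (pullbackName σ w x) ∂(m : Measure (V → X))) *
        ∫ x, g (pullbackName σ v x) * g' (pullbackName σ w x) ∂(m : Measure (V → X)) := by
  have hm : Measurable fun p : V → X × X =>
      tensor f g (pullbackName σ v p) * tensor f' g' (pullbackName σ w p) :=
    (measurable_apply_pullbackName _ σ v).mul (measurable_apply_pullbackName _ σ w)
  rw [integral_square hm, ← integral_prod_mul]
  congr 1
  ext q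
  exact mul_mul_mul_comm _ _ _ _

theorem abs_integral_mul_pullbackName_le {V : Type} (m : ProbabilityMeasure (V → X))
    (σ : G → Equiv.Perm V) (f g : C(G → X, ℝ)) (v w : V) :
    |∫ x, f (pullbackName σ v x) * g (pullbackName σ w x) ∂(m : Measure (V → X))| ≤ ‖f‖ * ‖g‖ :=
  abs_integral_le_of_abs_le fun _ => by
    rw [abs_mul]
    exact mul_le_mul (abs_apply_le_norm f _) (abs_apply_le_norm g _) (abs_nonneg _) (norm_nonneg _)

theorem abs_integral_mul_integral_le (μ : ProbabilityMeasure (G → X)) (f g : C(G → X, ℝ)) :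
    |(∫ y, f y ∂(μ : Measure (G → X))) * ∫ y, g y ∂(μ : Measure (G → X))| ≤ ‖f‖ * ‖g‖ := by
  rw [abs_mul]
  exact mul_le_mul (abs_integral_le_of_abs_le fun _ => abs_apply_le_norm f _)
    (abs_integral_le_of_abs_le fun _ => abs_apply_le_norm g _) (abs_nonneg _) (norm_nonneg _)

/-- Under the square measure a correlation of tensors is a product of two correlations under `m n`,
so its error telescopes into the errors of the two factors. -/
theorem pairDeviation_square_le (S : SoficApproximation G)
    (m : ∀ n, ProbabilityMeasure (S.V n → X)) (μ : ProbabilityMeasure (G → X))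
    (f g f' g' : C(G → X, ℝ)) (n : ℕ) :
    pairDeviation S (fun n => square (m n)) (square μ) (tensor f g) (tensor f' g') n ≤
      ‖g‖ * ‖g'‖ * pairDeviation S m μ f f' n + ‖f‖ * ‖f'‖ * pairDeviation S m μ g g' n := by
  simp only [pairDeviation]
  simp only [Finset.mul_expect, ← Finset.expect_add_distrib]
  refine expect_mono fun v => expect_mono fun w => ?_
  rw [integral_tensor_mul_pullbackName, integral_tensor_square, integral_tensor_square]
  have h1 := abs_integral_mul_pullbackName_le (m n) (S.σ n) g g' v w
  have h2 := abs_integral_mul_integral_le μ f f'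
  set A := ∫ x, f (pullbackName (S.σ n) v x) * f' (pullbackName (S.σ n) w x)
    ∂(m n : Measure (S.V n → X))
  set B := ∫ x, g (pullbackName (S.σ n) v x) * g' (pullbackName (S.σ n) w x)
    ∂(m n : Measure (S.V n → X))
  set a := ∫ y, f y ∂(μ : Measure (G → X))
  set a' := ∫ y, f' y ∂(μ : Measure (G → X))
  set b := ∫ y, g y ∂(μ : Measure (G → X))
  set b' := ∫ y, g' y ∂(μ : Measure (G → X))
  have h3 : A * B - a * b * (a' * b') = B * (A - a * a') + a * a' * (B - b * b') := by ring
  rw [h3]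
  refine (abs_add_le _ _).trans ?_
  rw [abs_mul B, abs_mul (a * a')]
  gcongr

variable {S : SoficApproximation G} {m : ∀ n, ProbabilityMeasure (S.V n → X)}
  {μ : ProbabilityMeasure (G → X)}

/-- Asymptotic decorrelation, tested on a point-separating multiplicative family, implies
doubly-quenched convergence. -/
theorem doublyQuenchedConverges_of_submonoid (T : Submonoid C(G → X, ℝ))
    (hT : ∀ x y : G → X, x ≠ y → ∃ f ∈ T, f x ≠ f y)
    (h : ∀ f ∈ T, ∀ g ∈ T, Tendsto (pairDeviation S m μ f g) atTop (𝓝 0)) :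
    DoublyQuenchedConverges S m μ := by
  let T2 : Submonoid C(G → X × X, ℝ) :=
    { carrier := {F | ∃ f ∈ T, ∃ g ∈ T, F = tensor f g}
      one_mem' := ⟨1, T.one_mem, 1, T.one_mem, tensor_one_one.symm⟩
      mul_mem' := by
        rintro _ _ ⟨f, hf, g, hg, rfl⟩ ⟨f', hf', g', hg', rfl⟩
        exact ⟨_, T.mul_mem hf hf', _, T.mul_mem hg hg', tensor_mul _ _ _ _⟩ }
  refine quenchedConverges_of_submonoid T2 (fun x y hxy => ?_) ?_
  · by_cases h1 : (fun i => (x i).1) = fun i => (y i).1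
    · by_cases h2 : (fun i => (x i).2) = fun i => (y i).2
      · exact absurd (funext fun i => Prod.ext (congrFun h1 i) (congrFun h2 i)) hxy
      · obtain ⟨f, hf, hne⟩ := hT _ _ h2
        exact ⟨tensor 1 f, ⟨1, T.one_mem, f, hf, rfl⟩, by simpa [tensor_apply] using hne⟩
    · obtain ⟨f, hf, hne⟩ := hT _ _ h1
      exact ⟨tensor f 1, ⟨f, hf, 1, T.one_mem, rfl⟩, by simpa [tensor_apply] using hne⟩
  · rintro _ ⟨f, hf, g, hg, rfl⟩ _ ⟨f', hf', g', hg', rfl⟩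
    refine squeeze_zero (fun n => pairDeviation_nonneg _ _ _ _ _ n)
      (fun n => pairDeviation_square_le S m μ f g f' g' n) ?_
    simpa using ((h f hf f' hf').const_mul (‖g‖ * ‖g'‖)).add
      ((h g hg g' hg').const_mul (‖f‖ * ‖f'‖))

theorem DoublyQuenchedConverges.tendsto_localDeviation (h : DoublyQuenchedConverges S m μ)
    (f : C(G → X, ℝ)) : Tendsto (localDeviation S m μ f) atTop (𝓝 0) := by
  refine (QuenchedConverges.tendsto_localDeviation h (tensor f 1)).congr fun n => ?_
  simp only [localDeviation, integral_tensor_pullbackName, integral_tensor_square]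
  simp

/-- The averaged squared correlation of two functions is at most the empirical deviation of the
tensor square of the first one. -/
theorem expect_sq_integral_le (S : SoficApproximation G) (m : ∀ n, ProbabilityMeasure (S.V n → X))
    {μ : ProbabilityMeasure (G → X)} {f : C(G → X, ℝ)} (g : C(G → X, ℝ))
    (hf : ∫ y, f y ∂(μ : Measure (G → X)) = 0) (n : ℕ) :
    𝔼 v, 𝔼 w, (∫ x, f (pullbackName (S.σ n) v x) * g (pullbackName (S.σ n) w x)
        ∂(m n : Measure (S.V n → X))) ^ 2 ≤
      ‖tensor g g‖ * empiricalDeviation S (fun n => square (m n)) (square μ) (tensor f f) n := by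
  -- The point of doubling: a squared correlation is itself a correlation, of `f ⊗ f` with `g ⊗ g`.
  -- Averaging over `v` and `w` then produces empirical averages, over which quenched convergence of
  -- the squares has control.
  have h1 : ∀ v w, (∫ x, f (pullbackName (S.σ n) v x) * g (pullbackName (S.σ n) w x)
        ∂(m n : Measure (S.V n → X))) ^ 2 = ∫ p, tensor f f (pullbackName (S.σ n) v p) *
          tensor g g (pullbackName (S.σ n) w p) ∂(square (m n) : Measure (S.V n → X × X)) := by
    intro v w
    rw [integral_tensor_mul_pullbackName, sq]
  have hi := integrable_mul_pullbackName (tensor f f) (tensor g g) (S.σ n)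
  have h2 : 𝔼 v, 𝔼 w, (∫ x, f (pullbackName (S.σ n) v x) * g (pullbackName (S.σ n) w x)
        ∂(m n : Measure (S.V n → X))) ^ 2 =
      ∫ p, (𝔼 v, tensor f f (pullbackName (S.σ n) v p)) *
        𝔼 w, tensor g g (pullbackName (S.σ n) w p) ∂(square (m n) : Measure (S.V n → X × X)) := by
    simp only [h1]
    have e : ∀ a : S.V n → S.V n → ℝ, 𝔼 v, 𝔼 w, a v w = 𝔼 p : S.V n × S.V n, a p.1 p.2 := by
      intro a
      rw [← Finset.univ_product_univ, Finset.expect_product]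
    simp only [Fintype.expect_mul_expect]
    rw [e]
    simp only [e]
    rw [integral_expect fun q : S.V n × S.V n => hi q.1 q.2 _]
  rw [h2, empiricalDeviation, ← integral_const_mul]
  have b1 : ∀ p, |𝔼 v, tensor f f (pullbackName (S.σ n) v p)| ≤ ‖tensor f f‖ :=
    abs_expect_pullbackName_le _ _
  have b2 : ∀ p, |𝔼 v, tensor g g (pullbackName (S.σ n) v p)| ≤ ‖tensor g g‖ :=
    abs_expect_pullbackName_le _ _
  have m1 := measurable_expect_pullbackName (tensor f f) (S.σ n)
  have m2 := measurable_expect_pullbackName (tensor g g) (S.σ n)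
  rw [integral_tensor_square, hf, zero_mul]
  simp only [sub_zero]
  refine integral_mono (integrable_of_abs_le (m1.mul m2) (C := ‖tensor f f‖ * ‖tensor g g‖)
    fun p => ?_) ((integrable_of_abs_le m1 b1).abs.const_mul _) fun p => ?_
  · rw [abs_mul]
    exact mul_le_mul (b1 p) (b2 p) (abs_nonneg _) (norm_nonneg _)
  · refine (le_abs_self _).trans ?_
    rw [abs_mul, mul_comm]
    exact mul_le_mul_of_nonneg_right (b2 p) (abs_nonneg _)

/-- Doubly-quenched convergence implies asymptotic decorrelation of all continuous functions. -/
theorem DoublyQuenchedConverges.tendsto_pairDeviation (h : DoublyQuenchedConverges S m μ)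
    (f g : C(G → X, ℝ)) : Tendsto (pairDeviation S m μ f g) atTop (𝓝 0) := by
  set a := ∫ y, f y ∂(μ : Measure (G → X)) with ha
  set b := ∫ y, g y ∂(μ : Measure (G → X)) with hb
  -- `expect_sq_integral_le` needs its first function to have mean zero. Undoing the centring costs
  -- only the local deviations of `f` and `g`.
  set f' : C(G → X, ℝ) := f - ContinuousMap.const _ a with hf'
  set g' : C(G → X, ℝ) := g - ContinuousMap.const _ b with hg'
  have hf0 : ∫ y, f' y ∂(μ : Measure (G → X)) = 0 := by
    simp only [hf', ContinuousMap.sub_apply, ContinuousMap.const_apply]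
    rw [integral_sub (integrable_apply _ f) (integrable_const _)]
    simp [ha]
  set c : ∀ n, S.V n → S.V n → ℝ := fun n v w =>
    ∫ x, f' (pullbackName (S.σ n) v x) * g' (pullbackName (S.σ n) w x)
      ∂(m n : Measure (S.V n → X)) with hc
  have h1 : Tendsto (fun n => 𝔼 v, 𝔼 w, |c n v w|) atTop (𝓝 0) := by
    have h2 : Tendsto (fun n => (𝔼 v, 𝔼 w, |c n v w|) ^ 2) atTop (𝓝 0) := by
      have h3 := (QuenchedConverges.tendsto_empiricalDeviation h (tensor f' f')).const_mul
        ‖tensor g' g'‖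
      rw [mul_zero] at h3
      refine squeeze_zero (fun n => sq_nonneg _) (fun n => ?_) h3
      refine le_trans ?_ (expect_sq_integral_le S m g' hf0 n)
      -- Jensen, once for each of the two averages, passes from absolute to squared correlations.
      refine (sq_expect_le _).trans (expect_mono fun v => (sq_expect_le _).trans_eq ?_)
      simp [hc]
    have h4 := h2.sqrt
    simpa [Real.sqrt_sq (expect_nonneg fun _ => expect_nonneg fun _ => abs_nonneg _)] using h4
  have h5 := (h1.add ((h.tendsto_localDeviation g).const_mul |a|)).add
    ((h.tendsto_localDeviation f).const_mul |b|)
  simp only [mul_zero, add_zero] at h5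
  refine squeeze_zero (fun n => pairDeviation_nonneg _ _ _ _ _ n) (fun n => ?_) h5
  have e : |b| * localDeviation S m μ f n = 𝔼 v, 𝔼 _w : S.V n, |b| *
      |∫ x, f (pullbackName (S.σ n) v x) ∂(m n : Measure (S.V n → X)) - a| := by
    simp only [Fintype.expect_const, ← Finset.mul_expect]
    rfl
  have e' : |a| * localDeviation S m μ g n = 𝔼 _v : S.V n, 𝔼 w, |a| *
      |∫ x, g (pullbackName (S.σ n) w x) ∂(m n : Measure (S.V n → X)) - b| := by
    rw [Fintype.expect_const, ← Finset.mul_expect]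
    rfl
  rw [e, e', pairDeviation]
  simp only [← Finset.expect_add_distrib]
  refine expect_mono fun v => expect_mono fun w => ?_
  have hcv : c n v w = ∫ x, f (pullbackName (S.σ n) v x) * g (pullbackName (S.σ n) w x)
      ∂(m n : Measure (S.V n → X)) - a * ∫ x, g (pullbackName (S.σ n) w x)
        ∂(m n : Measure (S.V n → X)) - b * ∫ x, f (pullbackName (S.σ n) v x)
          ∂(m n : Measure (S.V n → X)) + a * b := by
    have i1 := integrable_mul_pullbackName f g (S.σ n) v w (m n : Measure (S.V n → X))
    have i2 := integrable_apply_pullbackName g (S.σ n) w (m n : Measure (S.V n → X))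
    have i3 := integrable_apply_pullbackName f (S.σ n) v (m n : Measure (S.V n → X))
    have i4 : Integrable (fun x => f (pullbackName (S.σ n) v x) * g (pullbackName (S.σ n) w x) -
      a * g (pullbackName (S.σ n) w x)) (m n : Measure (S.V n → X)) := i1.sub (i2.const_mul a)
    rw [← integral_const_mul, ← integral_sub i1 (i2.const_mul a), ← integral_sub_mul_add i4 i3]
    refine integral_congr_ae (Eventually.of_forall fun x => ?_)
    simp [hf', hg']
    ring
  have h6 : ∫ x, f (pullbackName (S.σ n) v x) * g (pullbackName (S.σ n) w x)
      ∂(m n : Measure (S.V n → X)) - a * b = c n v w +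
      a * (∫ x, g (pullbackName (S.σ n) w x) ∂(m n : Measure (S.V n → X)) - b) +
      b * (∫ x, f (pullbackName (S.σ n) v x) ∂(m n : Measure (S.V n → X)) - a) := by
    rw [hcv]; ring
  rw [h6, ← abs_mul, ← abs_mul]
  exact abs_add_three _ _ _

end Square

theorem abs_prod_sub_prod_le {ι : Type*} (s : Finset ι) {a b : ι → ℝ} (ha : ∀ i, |a i| ≤ 1)
    (hb : ∀ i, |b i| ≤ 1) : |∏ i ∈ s, a i - ∏ i ∈ s, b i| ≤ ∑ i ∈ s, |a i - b i| := by
  classical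
  induction s using Finset.induction_on with
  | empty => simp
  | insert i s hi ih =>
    rw [Finset.prod_insert hi, Finset.prod_insert hi, Finset.sum_insert hi]
    have hp : |∏ i ∈ s, a i| ≤ 1 := by
      rw [Finset.abs_prod]
      exact Finset.prod_le_one (fun _ _ => abs_nonneg _) fun i _ => ha i
    have h : a i * ∏ i ∈ s, a i - b i * ∏ i ∈ s, b i =
        (a i - b i) * ∏ i ∈ s, a i + b i * (∏ i ∈ s, a i - ∏ i ∈ s, b i) := by ring
    rw [h]
    refine (abs_add_le _ _).trans (add_le_add ?_ ?_)
    · rw [abs_mul]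
      exact mul_le_of_le_one_right (abs_nonneg _) hp
    · rw [abs_mul]
      exact (mul_le_of_le_one_left (abs_nonneg _) (hb i)).trans ih

/-! ### Coordinatewise continuous images. -/

section Map

variable {G : Type*} [Group G] [Countable G] {X Y : Type*} [MetricSpace X] [CompactSpace X]
  [MeasurableSpace X] [BorelSpace X] [MetricSpace Y] [CompactSpace Y] [MeasurableSpace Y]
  [BorelSpace Y]

theorem measurable_comp_left {I : Type*} {X Y : Type*} [MeasurableSpace X] [MeasurableSpace Y]
    {φ : X → Y} (hφ : Measurable φ) : Measurable fun (x : I → X) (i : I) => φ (x i) :=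
  measurable_pi_lambda _ fun i => hφ.comp (measurable_pi_apply i)

/-- The image of a measure on `X^I` under a map applied to every coordinate. -/
noncomputable def mapCoord {I : Type*} {X Y : Type*} [MeasurableSpace X] [MeasurableSpace Y]
    {φ : X → Y} (hφ : Measurable φ) (m : ProbabilityMeasure (I → X)) : ProbabilityMeasure (I → Y) :=
  m.map (measurable_comp_left hφ).aemeasurable

theorem integral_mapCoord {I : Type*} {X Y : Type*} [MeasurableSpace X] [MeasurableSpace Y]
    {φ : X → Y} (hφ : Measurable φ) (m : ProbabilityMeasure (I → X)) {f : (I → Y) → ℝ}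
    (hf : Measurable f) : ∫ y, f y ∂(mapCoord hφ m : Measure (I → Y)) =
      ∫ x, f (fun i => φ (x i)) ∂(m : Measure (I → X)) := by
  rw [mapCoord, ProbabilityMeasure.toMeasure_map,
    integral_map (measurable_comp_left hφ).aemeasurable hf.aestronglyMeasurable]

/-- Coordinatewise continuous images of doubly-quenched convergent sequences are doubly-quenched
convergent. -/
theorem DoublyQuenchedConverges.map_continuous {S : SoficApproximation G}
    {m : ∀ n, ProbabilityMeasure (S.V n → Y)} {μ : ProbabilityMeasure (G → Y)}
    (h : DoublyQuenchedConverges S m μ) {φ : Y → X} (hφ : Continuous φ) :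
    DoublyQuenchedConverges S (fun n => mapCoord hφ.measurable (m n)) (mapCoord hφ.measurable μ) := by
  refine doublyQuenchedConverges_of_submonoid ⊤ (fun x y hxy => ?_) fun f _ g _ => ?_
  · obtain ⟨i, hi⟩ := Function.ne_iff.1 hxy
    refine ⟨⟨fun z => dist (z i) (x i), by fun_prop⟩, trivial, ?_⟩
    simpa using (dist_pos.2 hi.symm).ne
  -- The pair deviation of the images equals that of the functions composed with `φ`, so
  -- decorrelation transfers without loss.
  · let lift : C(G → X, ℝ) → C(G → Y, ℝ) := fun f =>
      f.comp ⟨fun y i => φ (y i), by fun_prop⟩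
    refine (h.tendsto_pairDeviation (lift f) (lift g)).congr fun n => ?_
    have hm : ∀ v w, Measurable fun x : S.V n → X =>
        f (pullbackName (S.σ n) v x) * g (pullbackName (S.σ n) w x) := fun v w =>
      (measurable_apply_pullbackName f _ v).mul (measurable_apply_pullbackName g _ w)
    simp only [pairDeviation]
    rw [integral_mapCoord _ _ f.continuous.measurable, integral_mapCoord _ _ g.continuous.measurable]
    simp only [integral_mapCoord _ _ (hm _ _)]
    rfl

end Map

/-! ### Cartesian powers. -/

section Power

variable {G : Type*} [Group G] {X : Type*} [MetricSpace X] {k : ℕ}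

/-- The function `f₁ ⊗ ⋯ ⊗ f_k` on `(X^k)^G`. -/
def tensorPow (f : Fin k → C(G → X, ℝ)) : C(G → Fin k → X, ℝ) where
  toFun p := ∏ j, f j fun i => p i j
  continuous_toFun := by fun_prop

theorem tensorPow_apply (f : Fin k → C(G → X, ℝ)) (p : G → Fin k → X) :
    tensorPow f p = ∏ j, f j fun i => p i j := rfl

variable [CompactSpace X] [MeasurableSpace X] [Countable G] [BorelSpace X]

theorem integral_power {I : Type*} {m : ProbabilityMeasure (I → X)} {F : (I → Fin k → X) → ℝ}
    (hF : Measurable F) :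
    ∫ p, F p ∂(power k m : Measure (I → Fin k → X)) =
      ∫ y, F (fun i j => y j i) ∂(Measure.pi fun _ : Fin k => (m : Measure (I → X))) := by
  rw [power, ProbabilityMeasure.toMeasure_map,
    integral_map (measurable_swapFun k).aemeasurable hF.aestronglyMeasurable,
    ProbabilityMeasure.toMeasure_pi]

theorem integral_tensorPow (μ : ProbabilityMeasure (G → X)) (f : Fin k → C(G → X, ℝ)) :
    ∫ p, tensorPow f p ∂(power k μ : Measure (G → Fin k → X)) =
      ∏ j, ∫ y, f j y ∂(μ : Measure (G → X)) := by
  rw [integral_power (tensorPow f).continuous.measurable, ← integral_fintype_prod_eq_prod]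
  rfl

theorem integral_tensorPow_mul_pullbackName {V : Type} (m : ProbabilityMeasure (V → X))
    (σ : G → Equiv.Perm V) (f g : Fin k → C(G → X, ℝ)) (v w : V) [Fintype V] :
    ∫ p, tensorPow f (pullbackName σ v p) * tensorPow g (pullbackName σ w p)
        ∂(power k m : Measure (V → Fin k → X)) =
      ∏ j, ∫ x, f j (pullbackName σ v x) * g j (pullbackName σ w x) ∂(m : Measure (V → X)) := by
  have hm : Measurable fun p : V → Fin k → X =>
      tensorPow f (pullbackName σ v p) * tensorPow g (pullbackName σ w p) :=
    (measurable_apply_pullbackName _ σ v).mul (measurable_apply_pullbackName _ σ w)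
  rw [integral_power hm, ← integral_fintype_prod_eq_prod]
  congr 1
  ext q
  rw [tensorPow_apply, tensorPow_apply, ← Finset.prod_mul_distrib]
  rfl

/-- Cartesian powers of doubly-quenched convergent sequences are doubly-quenched convergent. -/
theorem DoublyQuenchedConverges.power {S : SoficApproximation G}
    {m : ∀ n, ProbabilityMeasure (S.V n → X)} {μ : ProbabilityMeasure (G → X)}
    (h : DoublyQuenchedConverges S m μ) (k : ℕ) :
    DoublyQuenchedConverges S (fun n => power k (m n)) (SoficEntropy.power k μ) := by
  -- Correlations of tensors under the power measure are products over the `k` factors. Norms at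
  -- most `1` allow `abs_prod_sub_prod_le` to bound the error by the sum of the errors of the
  -- factors.
  let T : Submonoid C(G → Fin k → X, ℝ) :=
    { carrier := {F | ∃ f : Fin k → C(G → X, ℝ), (∀ j, ‖f j‖ ≤ 1) ∧ F = tensorPow f}
      one_mem' := by
        refine ⟨fun _ => 1, fun j => ?_, ?_⟩
        · exact (ContinuousMap.norm_le _ zero_le_one).2 fun x => by simp
        · ext p; simp [tensorPow_apply]
      mul_mem' := by
        rintro _ _ ⟨f, hf, rfl⟩ ⟨g, hg, rfl⟩
        refine ⟨fun j => f j * g j, fun j => ?_, ?_⟩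
        · exact (norm_mul_le _ _).trans (mul_le_one₀ (hf j) (norm_nonneg _) (hg j))
        · ext p; simp [tensorPow_apply, Finset.prod_mul_distrib] }
  refine doublyQuenchedConverges_of_submonoid T (fun x y hxy => ?_) ?_
  · obtain ⟨i, hi⟩ := Function.ne_iff.1 hxy
    obtain ⟨j, hj⟩ := Function.ne_iff.1 hi
    let u : C(G → X, ℝ) := ⟨fun z => min 1 (dist (z i) (x i j)), by fun_prop⟩
    have hu : ‖u‖ ≤ 1 := (ContinuousMap.norm_le _ zero_le_one).2 fun z => by
      change |min 1 (dist (z i) (x i j))| ≤ 1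
      rw [abs_of_nonneg (le_min zero_le_one dist_nonneg)]
      exact min_le_left _ _
    refine ⟨tensorPow (Function.update (fun _ => 1) j u), ⟨_, fun l => ?_, rfl⟩, ?_⟩
    · by_cases hl : l = j
      · subst hl; simpa using hu
      · rw [Function.update_of_ne hl]
        exact (ContinuousMap.norm_le _ zero_le_one).2 fun x => by simp
    · have e : ∀ p : G → Fin k → X, tensorPow (Function.update (fun _ => 1) j u) p =
          u fun i => p i j := by
        intro p
        rw [tensorPow_apply, Finset.prod_eq_single j]
        · simp
        · intro l _ hl; simp [Function.update_of_ne hl]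
        · simp
      rw [e, e]
      have : (0 : ℝ) < min 1 (dist (y i j) (x i j)) := lt_min zero_lt_one (dist_pos.2 (Ne.symm hj))
      simpa [u] using this.ne
  · rintro _ ⟨f, hf, rfl⟩ _ ⟨g, hg, rfl⟩
    refine squeeze_zero (g := fun n => ∑ j, pairDeviation S m μ (f j) (g j) n)
      (fun n => pairDeviation_nonneg _ _ _ _ _ n) (fun n => ?_) ?_
    · simp only [pairDeviation, ← Finset.expect_sum_comm]
      refine expect_mono fun v => expect_mono fun w => ?_
      rw [integral_tensorPow_mul_pullbackName, integral_tensorPow, integral_tensorPow,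
        ← Finset.prod_mul_distrib]
      refine abs_prod_sub_prod_le _ (fun j => ?_) fun j => ?_
      · exact (abs_integral_mul_pullbackName_le _ _ _ _ _ _).trans
          (mul_le_one₀ (hf j) (norm_nonneg _) (hg j))
      · exact (abs_integral_mul_integral_le _ _ _).trans
          (mul_le_one₀ (hf j) (norm_nonneg _) (hg j))
    · simpa using tendsto_finsetSum Finset.univ fun j _ => h.tendsto_pairDeviation (f j) (g j)

theorem mapCoord_eval_power {I : Type*} {X : Type*} [MeasurableSpace X]
    (μ : ProbabilityMeasure (I → X)) (j : Fin k) :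
    mapCoord (measurable_pi_apply j) (power k μ) = μ := by
  apply Subtype.ext
  change ((power k μ : Measure (I → Fin k → X)).map _) = (μ : Measure (I → X))
  rw [power, ProbabilityMeasure.toMeasure_map, ProbabilityMeasure.toMeasure_pi,
    Measure.map_map (measurable_comp_left (measurable_pi_apply j)) (measurable_swapFun k)]
  exact (measurePreserving_eval (fun _ : Fin k => (μ : Measure (I → X))) j).map_eq

end Power

/-! ### Covering numbers and their exponential rates. -/

section Covering

variable {V : Type} [Fintype V] {X : Type*} [MetricSpace X]

theorem hammingAvg_eq_expect (x y : V → X) : hammingAvg x y = 𝔼 v, dist (x v) (y v) :=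
  (Fintype.expect_eq_sum_div_card _).symm

theorem continuous_hammingAvg (x : V → X) : Continuous fun y : V → X => hammingAvg x y := by
  unfold hammingAvg
  fun_prop

theorem hammingAvg_nonneg (x y : V → X) : 0 ≤ hammingAvg x y := by
  rw [hammingAvg_eq_expect]
  exact expect_nonneg fun _ => dist_nonneg

theorem hammingAvg_triangle (x y z : V → X) :
    hammingAvg x z ≤ hammingAvg x y + hammingAvg y z := by
  simp only [hammingAvg_eq_expect, ← Finset.expect_add_distrib]
  exact expect_mono fun _ => dist_triangle _ _ _

theorem hammingAvg_comm (x y : V → X) : hammingAvg x y = hammingAvg y x := by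
  simp only [hammingAvg_eq_expect, dist_comm]

variable [MeasurableSpace X]

theorem covNum_le_card {ε δ : ℝ} {m : ProbabilityMeasure (V → X)} {F : Finset (V → X)}
    (h : 1 - ε < (m : Measure (V → X)).real {y | ∃ x ∈ F, hammingAvg x y < δ}) :
    covNum ε δ m ≤ (F.card : ℕ∞) :=
  iInf₂_le F h

/-- The real bound only ensures that the covering number is finite; an infimum of natural numbers is
then attained. -/
theorem exists_finset_of_covNum_le {ε δ : ℝ} {m : ProbabilityMeasure (V → X)} {N : ℝ}
    (h : (covNum ε δ m : ℝ≥0∞) ≤ ENNReal.ofReal N) :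
    ∃ F : Finset (V → X), 1 - ε < (m : Measure (V → X)).real {y | ∃ x ∈ F, hammingAvg x y < δ} ∧
      covNum ε δ m = (F.card : ℕ∞) := by
  have hne : covNum ε δ m ≠ ⊤ := by
    intro ht
    rw [ht] at h
    simp at h
  have hlt : covNum ε δ m < covNum ε δ m + 1 := ENat.lt_add_one_iff hne |>.2 le_rfl
  conv_lhs at hlt => rw [covNum]
  obtain ⟨F, hF⟩ := iInf_lt_iff.1 hlt
  obtain ⟨hF1, hF2⟩ := iInf_lt_iff.1 hF
  exact ⟨F, hF1, le_antisymm (covNum_le_card hF1) ((ENat.lt_add_one_iff hne).1 hF2)⟩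

/-- The exponential rate of the covering numbers. -/
noncomputable def covRate (ε δ : ℝ) (m : ProbabilityMeasure (V → X)) : EReal :=
  ENNReal.log (covNum ε δ m : ℝ≥0∞) / (Fintype.card V : EReal)

theorem covRate_mono {Y : Type*} [MetricSpace Y] [MeasurableSpace Y] {ε δ ε' δ' : ℝ}
    {m : ProbabilityMeasure (V → X)} {m' : ProbabilityMeasure (V → Y)}
    (h : covNum ε δ m ≤ covNum ε' δ' m') : covRate ε δ m ≤ covRate ε' δ' m' := by
  refine EReal.div_le_div_right_of_nonneg (by positivity) (ENNReal.log_monotone ?_)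
  exact_mod_cast h

variable [Nonempty V]

theorem covRate_le_iff {ε δ : ℝ} {m : ProbabilityMeasure (V → X)} {c : ℝ} :
    covRate ε δ m ≤ (c : EReal) ↔
      (covNum ε δ m : ℝ≥0∞) ≤ ENNReal.ofReal (Real.exp (c * Fintype.card V)) := by
  have h0 : (0 : EReal) < (Fintype.card V : EReal) := by exact_mod_cast Fintype.card_pos
  have h1 : (c : EReal) * (Fintype.card V : EReal) =
      ENNReal.log (ENNReal.ofReal (Real.exp (c * Fintype.card V))) := by
    rw [ENNReal.log_ofReal_of_pos (Real.exp_pos _), Real.log_exp]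
    push_cast
    rfl
  rw [covRate, EReal.div_le_iff_le_mul h0 (EReal.natCast_ne_top _), mul_comm, h1,
    ENNReal.log_le_log_iff]

theorem le_covRate_iff {ε δ : ℝ} {m : ProbabilityMeasure (V → X)} {c : ℝ} :
    (c : EReal) ≤ covRate ε δ m ↔
      ENNReal.ofReal (Real.exp (c * Fintype.card V)) ≤ (covNum ε δ m : ℝ≥0∞) := by
  have h0 : (0 : EReal) < (Fintype.card V : EReal) := by exact_mod_cast Fintype.card_pos
  have h1 : (c : EReal) * (Fintype.card V : EReal) =
      ENNReal.log (ENNReal.ofReal (Real.exp (c * Fintype.card V))) := by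
    rw [ENNReal.log_ofReal_of_pos (Real.exp_pos _), Real.log_exp]
    push_cast
    rfl
  rw [covRate, EReal.le_div_iff_mul_le h0 (EReal.natCast_ne_top _), h1, ENNReal.log_le_log_iff]

theorem covNum_pos {ε δ : ℝ} (hε : ε ≤ 1) (m : ProbabilityMeasure (V → X)) :
    1 ≤ covNum ε δ m := by
  refine le_iInf₂ fun F hF => ?_
  rw [Nat.one_le_cast, Nat.one_le_iff_ne_zero, Finset.card_ne_zero]
  rw [Finset.nonempty_iff_ne_empty]
  rintro rfl
  simp at hF
  linarith

variable [CompactSpace X] [BorelSpace X]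

theorem isOpen_setOf_hammingAvg_lt (x : V → X) (δ : ℝ) : IsOpen {y | hammingAvg x y < δ} :=
  isOpen_lt (continuous_hammingAvg x) continuous_const

theorem isOpen_setOf_exists_hammingAvg_lt (F : Finset (V → X)) (δ : ℝ) :
    IsOpen {y | ∃ x ∈ F, hammingAvg x y < δ} := by
  have : {y | ∃ x ∈ F, hammingAvg x y < δ} = ⋃ x ∈ F, {y | hammingAvg x y < δ} := by
    ext y; simp
  rw [this]
  exact isOpen_biUnion fun x _ => isOpen_setOf_hammingAvg_lt x δ

variable {k : ℕ}

theorem hammingAvg_eval_le (x y : V → Fin k → X) (j : Fin k) :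
    hammingAvg (fun v => x v j) (fun v => y v j) ≤ hammingAvg x y := by
  simp only [hammingAvg_eq_expect]
  exact expect_mono fun v => dist_le_pi_dist (x v) (y v) j

theorem hammingAvg_le_sum (x y : V → Fin k → X) :
    hammingAvg x y ≤ ∑ j, hammingAvg (fun v => x v j) (fun v => y v j) := by
  simp only [hammingAvg_eq_expect, ← Finset.expect_sum_comm]
  refine expect_mono fun v => (dist_pi_le_iff (Finset.sum_nonneg fun _ _ => dist_nonneg)).2 fun j => ?_
  exact Finset.single_le_sum (f := fun j => dist (x v j) (y v j)) (fun _ _ => dist_nonneg)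
    (Finset.mem_univ j)

/-- Combine the centres of the marginal coverings in all possible ways. The Hamming averages of the
coordinates add up, whence `δ / k`, and so do the exceptional measures, whence `ε / k`. No
independence of the coordinates is involved. -/
theorem covNum_le_prod (hk : 1 ≤ k) {ε δ : ℝ} (m : ProbabilityMeasure (V → Fin k → X))
    {F : Fin k → Finset (V → X)}
    (hF : ∀ j, 1 - ε / k < (mapCoord (measurable_pi_apply j) m : Measure (V → X)).real
      {y | ∃ x ∈ F j, hammingAvg x y < δ / k}) :
    covNum ε δ m ≤ ((∏ j, (F j).card : ℕ) : ℕ∞) := by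
  classical
  have hk0 : (0 : ℝ) < k := by exact_mod_cast hk
  have : NeZero k := ⟨by omega⟩
  let E : Finset (V → Fin k → X) := (Fintype.piFinset F).image fun p v j => p j v
  have hE : E.card ≤ ∏ j, (F j).card := by
    rw [← Fintype.card_piFinset]
    exact Finset.card_image_le
  refine le_trans (covNum_le_card (F := E) ?_) (by exact_mod_cast hE)
  set A : Fin k → Set (V → Fin k → X) := fun j =>
    {y | ∃ x ∈ F j, hammingAvg x (fun v => y v j) < δ / k} with hA
  have hmA : ∀ j, MeasurableSet (A j) := fun j =>
    (isOpen_setOf_exists_hammingAvg_lt (F j) (δ / k)).measurableSet.preimage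
      (measurable_comp_left (measurable_pi_apply j))
  have hA1 : ∀ j, (m : Measure (V → Fin k → X)).real (A j)ᶜ < ε / k := by
    intro j
    have h := hF j
    rw [mapCoord, ProbabilityMeasure.toMeasure_map, map_measureReal_apply
      (measurable_comp_left (measurable_pi_apply j))
      (isOpen_setOf_exists_hammingAvg_lt (F j) (δ / k)).measurableSet] at h
    rw [probReal_compl_eq_one_sub (hmA j)]
    have h' : 1 - ε / k < (m : Measure (V → Fin k → X)).real (A j) := h
    linarith
  have hsub : ⋂ j, A j ⊆ {y | ∃ x ∈ E, hammingAvg x y < δ} := by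
    intro y hy
    have hy' : ∀ j, ∃ x ∈ F j, hammingAvg x (fun v => y v j) < δ / k := fun j => Set.mem_iInter.1 hy j
    choose x hx hxy using hy'
    refine ⟨fun v j => x j v, Finset.mem_image.2 ⟨x, Fintype.mem_piFinset.2 hx, rfl⟩, ?_⟩
    refine (hammingAvg_le_sum _ _).trans_lt ?_
    calc _ < ∑ _j : Fin k, δ / k := Finset.sum_lt_sum_of_nonempty Finset.univ_nonempty fun j _ => hxy j
      _ = δ := by simp; field_simp
  refine lt_of_lt_of_le ?_ (measureReal_mono hsub)
  have hU : (m : Measure (V → Fin k → X)).real (⋃ j, (A j)ᶜ) < ε := by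
    refine (measureReal_iUnion_fintype_le _).trans_lt ?_
    calc _ < ∑ _j : Fin k, ε / k := Finset.sum_lt_sum_of_nonempty Finset.univ_nonempty fun j _ => hA1 j
      _ = ε := by simp; field_simp
  rw [← Set.compl_iInter, probReal_compl_eq_one_sub (MeasurableSet.iInter hmA)] at hU
  linarith

end Covering

/-- A greedy choice of at most `N` sets of a family such that each set of the family has measure at
most `1 / N` outside their union. -/
theorem exists_finset_measureReal_diff_le {Z : Type*} [MeasurableSpace Z] (m : Measure Z)
    [IsProbabilityMeasure m] {B : Z → Set Z} (hB : ∀ z, MeasurableSet (B z)) {N : ℝ} (hN : 0 < N) :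
    ∃ F : Finset Z, (F.card : ℝ) ≤ N ∧ ∀ x, m.real (B x \ ⋃ z ∈ F, B z) ≤ 1 / N := by
  classical
  by_contra! H
  -- If the claim fails, any family of at most `N` sets can be enlarged by one that adds measure
  -- more than `1 / N`. After `⌊N⌋₊ + 1` steps the total would exceed `1`.
  have h : ∀ j : ℕ, (j : ℝ) ≤ N + 1 →
      ∃ F : Finset Z, F.card ≤ j ∧ (j : ℝ) / N ≤ m.real (⋃ z ∈ F, B z) := by
    intro j
    induction j with
    | zero => intro _; exact ⟨∅, by simp, by simp⟩
    | succ j ih =>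
      intro hj
      push_cast at hj
      obtain ⟨F, hF1, hF2⟩ := ih (by linarith)
      obtain ⟨x, hx⟩ := H F ((Nat.cast_le.2 hF1).trans (by linarith))
      refine ⟨insert x F, (Finset.card_insert_le _ _).trans (by omega), ?_⟩
      have hU : MeasurableSet (⋃ z ∈ F, B z) := Finset.measurableSet_biUnion _ fun z _ => hB z
      have he : ⋃ z ∈ insert x F, B z = (⋃ z ∈ F, B z) ∪ (B x \ ⋃ z ∈ F, B z) := by
        rw [Finset.set_biUnion_insert, Set.union_sdiff_self, Set.union_comm]
      rw [he, measureReal_union Set.disjoint_sdiff_right ((hB x).diff hU)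
        (measure_ne_top _ _) (measure_ne_top _ _)]
      push_cast
      rw [add_div]
      linarith
  obtain ⟨F, _, hF⟩ := h (⌊N⌋₊ + 1) (by push_cast; linarith [Nat.floor_le hN.le])
  have h1 : m.real (⋃ z ∈ F, B z) ≤ 1 := measureReal_le_one
  have h2 : 1 < ((⌊N⌋₊ + 1 : ℕ) : ℝ) / N := by
    rw [one_lt_div hN]; push_cast; exact Nat.lt_floor_add_one N
  linarith

/-! ### Lower bound for the covering numbers of a power. -/

section CoveringPower

variable {V : Type} [Fintype V] [Nonempty V] {X : Type*} [MetricSpace X] [CompactSpace X]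
  [MeasurableSpace X] [BorelSpace X] {k : ℕ}

theorem measureReal_power_box (m : ProbabilityMeasure (V → X)) {A : Fin k → Set (V → X)}
    (hA : ∀ j, MeasurableSet (A j)) :
    (power k m : Measure (V → Fin k → X)).real {p | ∀ j, (fun v => p v j) ∈ A j} =
      ∏ j, (m : Measure (V → X)).real (A j) := by
  have hs : MeasurableSet {p : V → Fin k → X | ∀ j, (fun v => p v j) ∈ A j} := by
    rw [Set.ofPred_forall]
    exact MeasurableSet.iInter fun j =>
      (hA j).preimage (measurable_comp_left (measurable_pi_apply j))
  rw [power, ProbabilityMeasure.toMeasure_map, map_measureReal_apply (measurable_swapFun k) hs,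
    ProbabilityMeasure.toMeasure_pi]
  have : (fun (y : Fin k → V → X) (i : V) (j : Fin k) => y j i) ⁻¹'
      {p : V → Fin k → X | ∀ j, (fun v => p v j) ∈ A j} = Set.univ.pi A := by
    ext y; simp
  rw [this, Measure.real, Measure.pi_pi, ENNReal.toReal_prod]
  rfl

/-- Let `U` be the union of the greedily chosen balls. There are at most `N` of them, too few for a
covering, so `Uᶜ` has measure at least `ε` and its `k`-th power at least `ε^k`. A ball for the
supremum metric lies in a product of balls, each of measure at most `1 / N` outside `U`, so it meets
that power in measure at most `N^{-k}`. A set of centres missing less than `ε^k / 2` must still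
cover measure more than `ε^k / 2` there. -/
theorem le_covNum_power (m : ProbabilityMeasure (V → X)) {ε δ N : ℝ} (hε : 0 < ε) (hN : 0 < N)
    (h : ENNReal.ofReal N < (covNum ε δ m : ℝ≥0∞)) :
    ENNReal.ofReal (ε ^ k / 2 * N ^ k) ≤ (covNum (ε ^ k / 2) δ (power k m) : ℝ≥0∞) := by
  obtain ⟨F, hFc, hF⟩ := exists_finset_measureReal_diff_le (m : Measure (V → X))
    (B := fun x => {y | hammingAvg x y < δ}) (fun x => (isOpen_setOf_hammingAvg_lt x δ).measurableSet) hN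
  set U : Set (V → X) := ⋃ z ∈ F, {y | hammingAvg z y < δ} with hU
  have hUe : U = {y | ∃ x ∈ F, hammingAvg x y < δ} := by ext y; simp [hU]
  have hUm : MeasurableSet U := hUe ▸ (isOpen_setOf_exists_hammingAvg_lt F δ).measurableSet
  have hU1 : ε ≤ (m : Measure (V → X)).real Uᶜ := by
    rw [probReal_compl_eq_one_sub hUm]
    by_contra hlt
    have h1 : covNum ε δ m ≤ (F.card : ℕ∞) := covNum_le_card (by rw [← hUe]; linarith)
    have h2 : (covNum ε δ m : ℝ≥0∞) ≤ ((F.card : ℕ∞) : ℝ≥0∞) := by exact_mod_cast h1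
    refine absurd (h.trans_le h2) (not_lt.2 ?_)
    rw [ENat.toENNReal_coe, ← ENNReal.ofReal_natCast]
    exact ENNReal.ofReal_le_ofReal hFc
  by_contra! hlt
  obtain ⟨E, hE, hEc⟩ := exists_finset_of_covNum_le hlt.le
  rw [hEc, ENat.toENNReal_coe, ← ENNReal.ofReal_natCast,
    ENNReal.ofReal_lt_ofReal_iff (by positivity)] at hlt
  set P : Measure (V → Fin k → X) := (power k m : Measure (V → Fin k → X)) with hP
  set R : Set (V → Fin k → X) := {p | ∀ j : Fin k, (fun v => p v j) ∈ Uᶜ} with hR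
  have hR1 : ε ^ k ≤ P.real R := by
    rw [hP, measureReal_power_box m fun _ => hUm.compl, Finset.prod_const, Finset.card_univ,
      Fintype.card_fin]
    exact pow_le_pow_left₀ hε.le hU1 k
  set W : Set (V → Fin k → X) := {y | ∃ x ∈ E, hammingAvg x y < δ} with hW
  have hWm : MeasurableSet W := (isOpen_setOf_exists_hammingAvg_lt E δ).measurableSet
  have h1 : P.real R ≤ P.real (R ∩ W) + P.real Wᶜ := by
    refine le_trans (measureReal_mono ?_) (measureReal_union_le _ _)
    intro p hp
    by_cases hpW : p ∈ W
    · exact Or.inl ⟨hp, hpW⟩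
    · exact Or.inr hpW
  rw [probReal_compl_eq_one_sub hWm] at h1
  have h2 : R ∩ W ⊆ ⋃ x ∈ E, {p | ∀ j : Fin k, (fun v => p v j) ∈
      {y | hammingAvg (fun v => x v j) y < δ} \ U} := by
    rintro p ⟨hpR, x, hx, hxp⟩
    refine Set.mem_biUnion hx fun j => ⟨?_, hpR j⟩
    exact (hammingAvg_eval_le x p j).trans_lt hxp
  have h3 : P.real (R ∩ W) ≤ E.card * (1 / N) ^ k := by
    refine (measureReal_mono h2 (measure_ne_top _ _)).trans ((measureReal_biUnion_finset_le _ _).trans ?_)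
    rw [← nsmul_eq_mul]
    refine Finset.sum_le_card_nsmul _ _ _ fun x _ => ?_
    rw [hP, measureReal_power_box m fun j =>
      (isOpen_setOf_hammingAvg_lt _ δ).measurableSet.diff hUm]
    calc _ ≤ ∏ _j : Fin k, 1 / N := Finset.prod_le_prod (fun _ _ => measureReal_nonneg)
          fun j _ => hF fun v => _
      _ = _ := by simp
  have h4 : (E.card : ℝ) * (1 / N) ^ k < ε ^ k / 2 := by
    rw [one_div, inv_pow, ← div_eq_mul_inv, div_lt_iff₀ (by positivity)]
    exact hlt
  linarith

end CoveringPower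

/-! ### The degenerate case: `|V n|` does not tend to infinity. -/

section Bounded

variable {G : Type*} [Group G] [Countable G] {X : Type*} [MetricSpace X] [CompactSpace X]
  [MeasurableSpace X] [BorelSpace X] {S : SoficApproximation G}
  {m : ∀ n, ProbabilityMeasure (S.V n → X)} {μ : ProbabilityMeasure (G → X)}

/-- The diagonal part of the pair deviation. -/
theorem abs_expect_sub_le_card_mul_pairDeviation (S : SoficApproximation G)
    (m : ∀ n, ProbabilityMeasure (S.V n → X)) (μ : ProbabilityMeasure (G → X))
    (f : C(G → X, ℝ)) (n : ℕ) :
    |𝔼 v, ∫ x, (f * f) (pullbackName (S.σ n) v x) ∂(m n : Measure (S.V n → X)) -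
      (∫ y, f y ∂(μ : Measure (G → X))) ^ 2| ≤
        Fintype.card (S.V n) * pairDeviation S m μ f f n := by
  refine (abs_expect_sub_le _ _).trans ?_
  rw [pairDeviation, Finset.mul_expect]
  refine expect_mono fun v => ?_
  rw [Fintype.card_mul_expect, sq]
  exact Finset.single_le_sum (f := fun w =>
    |∫ x, f (pullbackName (S.σ n) v x) * f (pullbackName (S.σ n) w x) ∂(m n : Measure (S.V n → X)) -
      (∫ y, f y ∂(μ : Measure (G → X))) * ∫ y, f y ∂(μ : Measure (G → X))|)
    (fun _ _ => abs_nonneg _) (Finset.mem_univ v)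

/-- When `|V n| < M` for infinitely many `n`, the diagonal `v = w` has weight more than `1 / M`
among all pairs. Decorrelation then holds on the diagonal too, which says that `f` has variance zero
under `μ`. -/
theorem DoublyQuenchedConverges.ae_eq_integral (h : DoublyQuenchedConverges S m μ)
    (hV : ¬ Tendsto (fun n => Fintype.card (S.V n)) atTop atTop) (f : C(G → X, ℝ)) :
    ∀ᵐ y ∂(μ : Measure (G → X)), f y = ∫ y, f y ∂(μ : Measure (G → X)) := by
  set a := ∫ y, f y ∂(μ : Measure (G → X)) with ha
  obtain ⟨M, hM⟩ : ∃ M, ∃ᶠ n in atTop, Fintype.card (S.V n) < M := by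
    simpa [tendsto_atTop, frequently_atTop] using hV
  have h1 : ∫ y, (f * f) y ∂(μ : Measure (G → X)) = a ^ 2 := by
    by_contra hne
    have hD : 0 < |∫ y, (f * f) y ∂(μ : Measure (G → X)) - a ^ 2| := abs_pos.2 (sub_ne_zero.2 hne)
    set D := |∫ y, (f * f) y ∂(μ : Measure (G → X)) - a ^ 2|
    have h2 := (h.tendsto_localDeviation (f * f)).add ((h.tendsto_pairDeviation f f).const_mul (M : ℝ))
    rw [mul_zero, add_zero] at h2
    obtain ⟨n, hn, hn2⟩ := (hM.and_eventually (h2.eventually_lt_const hD)).exists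
    have h3 := abs_expect_sub_le_card_mul_pairDeviation S m μ f n
    have h4 := abs_expect_sub_le (fun v => ∫ x, (f * f) (pullbackName (S.σ n) v x)
      ∂(m n : Measure (S.V n → X))) (∫ y, (f * f) y ∂(μ : Measure (G → X)))
    have h5 : (Fintype.card (S.V n) : ℝ) * pairDeviation S m μ f f n ≤
        M * pairDeviation S m μ f f n := by
      gcongr
      exact pairDeviation_nonneg _ _ _ _ _ _
    have h6 := abs_sub_le (∫ y, (f * f) y ∂(μ : Measure (G → X)))
      (𝔼 v, ∫ x, (f * f) (pullbackName (S.σ n) v x) ∂(m n : Measure (S.V n → X))) (a ^ 2)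
    rw [abs_sub_comm] at h4
    have h7 : localDeviation S m μ (f * f) n = 𝔼 v, |∫ x, (f * f) (pullbackName (S.σ n) v x)
      ∂(m n : Measure (S.V n → X)) - ∫ y, (f * f) y ∂(μ : Measure (G → X))| := rfl
    linarith
  have h2 : ∫ y, (f y - a) ^ 2 ∂(μ : Measure (G → X)) = 0 := by
    have e : ∀ y, (f y - a) ^ 2 = (f * f) y - 2 * a * f y + a ^ 2 := fun y => by
      simp only [ContinuousMap.mul_apply]; ring
    simp only [e]
    rw [integral_sub_mul_add (integrable_apply _ (f * f)) (integrable_apply _ f), h1, ← ha]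
    ring
  have hi : Integrable (fun y => (f y - a) ^ 2) (μ : Measure (G → X)) :=
    integrable_apply _ ⟨fun y => (f y - a) ^ 2, by fun_prop⟩
  filter_upwards [(integral_eq_zero_iff_of_nonneg (fun y => sq_nonneg _) hi).1 h2] with y hy
  have : f y - a = 0 := by simpa using hy
  linarith

/-- The distances to a countable dense set are almost surely constant, and they determine the point.
-/
theorem DoublyQuenchedConverges.exists_ae_eq (h : DoublyQuenchedConverges S m μ)
    (hV : ¬ Tendsto (fun n => Fintype.card (S.V n)) atTop atTop) :
    ∃ a : X, ∀ᵐ y ∂(μ : Measure (G → X)), y 1 = a := by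
  obtain ⟨y₀⟩ : Nonempty (G → X) := (μ : Measure (G → X)).nonempty_of_neZero
  have : Nonempty X := ⟨y₀ 1⟩
  let f : ℕ → C(G → X, ℝ) := fun i => ⟨fun y => dist (y 1) (TopologicalSpace.denseSeq X i), by fun_prop⟩
  have h1 := ae_all_iff.2 fun i => h.ae_eq_integral hV (f i)
  obtain ⟨y₁, hy₁⟩ := h1.exists
  refine ⟨y₁ 1, ?_⟩
  filter_upwards [h1] with y hy
  refine eq_of_forall_dist_le fun ε hε => ?_
  obtain ⟨i, hi⟩ := Metric.denseRange_iff.1 (TopologicalSpace.denseRange_denseSeq X) (y 1) (ε / 2)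
    (by positivity)
  have h2 : dist (y 1) (TopologicalSpace.denseSeq X i) =
      dist (y₁ 1) (TopologicalSpace.denseSeq X i) := (hy i).trans (hy₁ i).symm
  have := dist_triangle_right (y 1) (y₁ 1) (TopologicalSpace.denseSeq X i)
  linarith

/-- The mean Hamming distance to the constant configuration `a` is the local deviation of `y ↦ dist
a (y 1)`, which tends to zero along the whole sequence. By Markov a single ball eventually suffices.
-/
theorem DoublyQuenchedConverges.limsup_covRate_le_zero (h : DoublyQuenchedConverges S m μ)
    (hV : ¬ Tendsto (fun n => Fintype.card (S.V n)) atTop atTop) {ε δ : ℝ} (hε : 0 < ε)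
    (hδ : 0 < δ) : limsup (fun n => covRate ε δ (m n)) atTop ≤ 0 := by
  obtain ⟨a, ha⟩ := h.exists_ae_eq hV
  let f : C(G → X, ℝ) := ⟨fun y => dist a (y 1), by fun_prop⟩
  have hf : ∫ y, f y ∂(μ : Measure (G → X)) = 0 := by
    refine integral_eq_zero_of_ae ?_
    filter_upwards [ha] with y hy
    simp [f, hy]
  have hint : ∀ n, localDeviation S m μ f n =
      ∫ x, hammingAvg (fun _ => a) x ∂(m n : Measure (S.V n → X)) := by
    intro n
    simp only [localDeviation, hf, sub_zero, hammingAvg_eq_expect]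
    have h1 : ∀ v, |∫ x, f (pullbackName (S.σ n) v x) ∂(m n : Measure (S.V n → X))| =
        ∫ x, dist a (x (S.σ n 1 v)) ∂(m n : Measure (S.V n → X)) := fun v =>
      abs_of_nonneg (integral_nonneg fun _ => dist_nonneg)
    simp only [h1]
    -- `S.σ n 1` need not be the identity, but it is a permutation, so it disappears on averaging
    -- over vertices.
    rw [expect_perm (S.σ n 1) fun v => ∫ x, dist a (x v) ∂(m n : Measure (S.V n → X)),
      integral_expect]
    exact fun v => integrable_apply _ ⟨fun x : S.V n → X => dist a (x v), by fun_prop⟩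
  have h1 := (h.tendsto_localDeviation f).const_mul δ⁻¹
  rw [mul_zero] at h1
  refine limsup_le_of_le (by isBoundedDefault) ?_
  filter_upwards [h1.eventually_lt_const hε] with n hn
  change _ ≤ ((0 : ℝ) : EReal)
  rw [covRate_le_iff]
  have h2 : covNum ε δ (m n) ≤ (({fun _ => a} : Finset (S.V n → X)).card : ℕ∞) := by
    refine covNum_le_card ?_
    have hm : MeasurableSet {y : S.V n → X | hammingAvg (fun _ => a) y < δ} :=
      (isOpen_setOf_hammingAvg_lt _ δ).measurableSet
    have h3 : Integrable (fun x => hammingAvg (fun _ => a) x) (m n : Measure (S.V n → X)) :=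
      integrable_apply _ ⟨_, continuous_hammingAvg (V := S.V n) fun _ => a⟩
    have h4 := mul_meas_ge_le_integral_of_nonneg
      (Eventually.of_forall fun x => hammingAvg_nonneg (fun _ : S.V n => a) x) h3 δ
    rw [← hint] at h4
    have h5 : {x : S.V n → X | δ ≤ hammingAvg (fun _ => a) x} =
        {y | hammingAvg (fun _ => a) y < δ}ᶜ := by ext; simp
    rw [h5, probReal_compl_eq_one_sub hm, ← le_inv_mul_iff₀ hδ] at h4
    simp only [Finset.mem_singleton, exists_eq_left]
    linarith
  simp only [Finset.card_singleton, Nat.cast_one] at h2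
  rw [zero_mul, Real.exp_zero, ENNReal.ofReal_one]
  exact_mod_cast h2

end Bounded

/-! ### Additivity for the supremum metric. -/

section Entropy

variable {G : Type*} [Group G] [Countable G] {X : Type*} [MetricSpace X] [CompactSpace X]
  [MeasurableSpace X] [BorelSpace X] {S : SoficApproximation G} {μ : ProbabilityMeasure (G → X)}

theorem le_dqEntropy {n : ℕ → ℕ} {hn : StrictMono n}
    {m : ∀ i, ProbabilityMeasure ((S.sub n hn).V i → X)}
    (hm : DoublyQuenchedConverges (S.sub n hn) m μ) {ε δ : ℝ} (hε : 0 < ε) (hδ : 0 < δ) :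
    limsup (fun i => covRate ε δ (m i)) atTop ≤ dqEntropy S μ :=
  le_iSup_of_le n <| le_iSup_of_le hn <| le_iSup_of_le m <| le_iSup_of_le hm <|
    le_iSup_of_le δ <| le_iSup_of_le hδ <| le_iSup_of_le ε <| le_iSup_of_le hε le_rfl

theorem dqEntropy_le {L : EReal} (h : ∀ (n : ℕ → ℕ) (hn : StrictMono n)
    (m : ∀ i, ProbabilityMeasure ((S.sub n hn).V i → X)),
    DoublyQuenchedConverges (S.sub n hn) m μ → ∀ ε δ : ℝ, 0 < ε → 0 < δ →
      limsup (fun i => covRate ε δ (m i)) atTop ≤ L) : dqEntropy S μ ≤ L :=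
  iSup_le fun n => iSup_le fun hn => iSup_le fun m => iSup_le fun hm => iSup_le fun δ =>
    iSup_le fun hδ => iSup_le fun ε => iSup_le fun hε => h n hn m hm ε δ hε hδ

/-- Real thresholds `c = z / k` handle the infinite values of `h` and `L` together with the finite
ones. -/
theorem le_natCast_mul_of_forall {k : ℕ} (hk : 1 ≤ k) {h L : EReal}
    (H : ∀ c : ℝ, h < c → L ≤ ((k * c : ℝ) : EReal)) : L ≤ k * h := by
  have hk0 : (k : ℝ) ≠ 0 := by positivity
  rw [← EReal.le_of_forall_lt_iff_le]
  intro z hz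
  have hkz : (k : ℝ) * (z / k) = z := by field_simp
  refine (H (z / k) (lt_of_not_ge fun hle => hz.not_ge ?_)).trans_eq (by rw [hkz])
  calc ((z : ℝ) : EReal) = (k : EReal) * ((z / k : ℝ) : EReal) := by
        rw [← EReal.coe_natCast, ← EReal.coe_mul, hkz]
    _ ≤ k * h := mul_le_mul_of_nonneg_left hle (by positivity)

theorem natCast_mul_le_of_forall {k : ℕ} (hk : 1 ≤ k) {h L : EReal}
    (H : ∀ c : ℝ, c < h → ((k * c : ℝ) : EReal) ≤ L) : k * h ≤ L := by
  have hk0 : (k : ℝ) ≠ 0 := by positivity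
  rw [← EReal.ge_of_forall_gt_iff_ge]
  intro z hz
  have hkz : (k : ℝ) * (z / k) = z := by field_simp
  refine le_trans (by rw [hkz]) (H (z / k) (lt_of_not_ge fun hle => hz.not_ge ?_))
  calc k * h ≤ (k : EReal) * ((z / k : ℝ) : EReal) := mul_le_mul_of_nonneg_left hle (by positivity)
    _ = (z : EReal) := by rw [← EReal.coe_natCast, ← EReal.coe_mul, hkz]

/-- The measures `m i` need not be products, but evaluation at a coordinate `j` is continuous, so
each marginal sequence competes in the supremum defining `dqEntropy S μ`. -/
theorem dqEntropy_power_le {k : ℕ} (hk : 1 ≤ k) (S : SoficApproximation G)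
    (μ : ProbabilityMeasure (G → X)) : dqEntropy S (power k μ) ≤ k * dqEntropy S μ := by
  have hk0 : (0 : ℝ) < k := by exact_mod_cast hk
  refine dqEntropy_le fun n hn m hm ε δ hε hδ => le_natCast_mul_of_forall hk fun c hc => ?_
  have h1 : ∀ j, limsup (fun i => covRate (ε / k) (δ / k)
      (mapCoord (measurable_pi_apply j) (m i))) atTop ≤ dqEntropy S μ := by
    intro j
    have h2 := hm.map_continuous (continuous_apply j)
    rw [mapCoord_eval_power] at h2
    exact le_dqEntropy h2 (by positivity) (by positivity)
  have h2 : ∀ᶠ i in atTop, ∀ j, covRate (ε / k) (δ / k)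
      (mapCoord (measurable_pi_apply j) (m i)) < c :=
    eventually_all.2 fun j => eventually_lt_of_limsup_lt ((h1 j).trans_lt hc)
  refine limsup_le_of_le (by isBoundedDefault) ?_
  filter_upwards [h2] with i hi
  have h3 := fun j => exists_finset_of_covNum_le (covRate_le_iff.1 (hi j).le)
  choose F hF hFc using h3
  rw [covRate_le_iff]
  have h4 : (covNum ε δ (m i) : ℝ≥0∞) ≤ ((∏ j, (F j).card : ℕ) : ℝ≥0∞) := by
    rw [← ENat.toENNReal_coe]
    exact ENat.toENNReal_mono (covNum_le_prod hk (m i) hF)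
  refine h4.trans ?_
  rw [← ENNReal.ofReal_natCast]
  refine ENNReal.ofReal_le_ofReal ?_
  push_cast
  calc ∏ j, ((F j).card : ℝ) ≤ ∏ _j : Fin k, Real.exp (c * Fintype.card ((S.sub n hn).V i)) := by
        refine Finset.prod_le_prod (fun _ _ => by positivity) fun j _ => ?_
        have := covRate_le_iff.1 (hi j).le
        rw [hFc j, ENat.toENNReal_coe, ← ENNReal.ofReal_natCast,
          ENNReal.ofReal_le_ofReal_iff (Real.exp_pos _).le] at this
        exact this
    _ = Real.exp (k * c * Fintype.card ((S.sub n hn).V i)) := by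
        rw [Finset.prod_const, Finset.card_univ, Fintype.card_fin, ← Real.exp_nat_mul]
        ring_nf

theorem le_dqEntropy_power {k : ℕ} (hk : 1 ≤ k) (S : SoficApproximation G)
    (μ : ProbabilityMeasure (G → X)) : k * dqEntropy S μ ≤ dqEntropy S (power k μ) := by
  have hk0 : (0 : ℝ) < k := by exact_mod_cast hk
  refine natCast_mul_le_of_forall hk fun c hc => ?_
  simp only [dqEntropy, lt_iSup_iff] at hc
  obtain ⟨n, hn, m, hm, δ, hδ, ε, hε, hc⟩ := hc
  change _ < limsup (fun i => covRate ε δ (m i)) atTop at hc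
  -- The gap `k (c' - c) |V|` will absorb the constant `log (ε ^ k / 2)` as `|V|` grows.
  obtain ⟨c', hc1, hc2⟩ := EReal.lt_iff_exists_real_btwn.1 hc
  rw [EReal.coe_lt_coe_iff] at hc1
  by_cases hV : Tendsto (fun i => Fintype.card ((S.sub n hn).V i)) atTop atTop
  · refine le_trans ?_ (le_dqEntropy (hm.power k) (ε := ε ^ k / 2) (by positivity) hδ)
    refine le_limsup_of_frequently_le ?_ (by isBoundedDefault)
    have hfr := frequently_lt_of_lt_limsup (by isBoundedDefault) hc2
    have hV' : Tendsto (fun i => (Fintype.card ((S.sub n hn).V i) : ℝ)) atTop atTop :=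
      tendsto_natCast_atTop_atTop.comp hV
    have hev := (hV'.const_mul_atTop (show 0 < k * (c' - c) by
      exact mul_pos hk0 (sub_pos.2 hc1))).eventually_ge_atTop (-Real.log (ε ^ k / 2))
    refine (hfr.and_eventually hev).mono fun i hi => ?_
    obtain ⟨h1, h2⟩ := hi
    rw [← not_le, covRate_le_iff, not_le] at h1
    rw [le_covRate_iff]
    refine le_trans (ENNReal.ofReal_le_ofReal ?_) (le_covNum_power (m i) hε (Real.exp_pos _) h1)
    rw [← Real.exp_nat_mul, ← Real.exp_log (show 0 < ε ^ k / 2 by positivity), ← Real.exp_add]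
    refine Real.exp_le_exp.2 ?_
    linarith
  -- Here the rates are at most zero, so `c ≤ 0`. It is enough that the powers converge at all and
  -- that covering numbers for `ε = 1` are at least one.
  · have h1 := hc2.trans_le (hm.limsup_covRate_le_zero hV hε hδ)
    have h2 : c ≤ 0 := by
      have : c' < 0 := by exact_mod_cast h1
      linarith
    refine le_trans ?_ (le_dqEntropy (hm.power k) (ε := 1) (δ := 1) one_pos one_pos)
    refine le_limsup_of_frequently_le (Frequently.of_forall fun i => ?_) (by isBoundedDefault)
    rw [le_covRate_iff]
    have h3 : (1 : ℝ≥0∞) ≤ (covNum 1 1 (power k (m i)) : ℝ≥0∞) := by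
      exact_mod_cast covNum_pos le_rfl (power k (m i))
    refine le_trans ?_ h3
    rw [ENNReal.ofReal_le_one, Real.exp_le_one_iff]
    exact mul_nonpos_of_nonpos_of_nonneg (mul_nonpos_of_nonneg_of_nonpos hk0.le h2) (by positivity)

/-- Additivity of the doubly-quenched entropy for the product metric. -/
theorem dqEntropy_power {k : ℕ} (hk : 1 ≤ k) (S : SoficApproximation G)
    (μ : ProbabilityMeasure (G → X)) : dqEntropy S (power k μ) = k * dqEntropy S μ :=
  le_antisymm (dqEntropy_power_le hk S μ) (le_dqEntropy_power hk S μ)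

end Entropy

/-- Diagonalization: if each `P r` holds eventually, then so does `P (ρ n) n` for some `ρ → ∞`. -/
theorem exists_tendsto_eventually_of_forall {P : ℕ → ℕ → Prop}
    (h : ∀ r, ∀ᶠ n in atTop, P r n) :
    ∃ ρ : ℕ → ℕ, Tendsto ρ atTop atTop ∧ ∀ᶠ n in atTop, P (ρ n) n := by
  simp only [eventually_atTop] at h
  choose N hN using h
  -- `ρ n` is the largest `r ≤ n` whose threshold `N r` has been passed.
  refine ⟨fun n => Nat.findGreatest (fun r => N r ≤ n) n, tendsto_atTop.2 fun b => ?_, ?_⟩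
  · filter_upwards [eventually_ge_atTop (max b (N b))] with n hn
    exact Nat.le_findGreatest (le_of_max_le_left hn) (le_of_max_le_right hn)
  · filter_upwards [eventually_ge_atTop (N 0)] with n hn
    exact hN _ n (Nat.findGreatest_spec (P := fun r => N r ≤ n) (Nat.zero_le n) hn)

/-! ### Finite-valued approximation of a Borel map. -/

section Approximation

variable {X Y : Type*} [MetricSpace X] [CompactSpace X] [MeasurableSpace X] [BorelSpace X]
  [MetricSpace Y] [CompactSpace Y] [MeasurableSpace Y] [BorelSpace Y]

theorem exists_continuousMap_integral_abs_sub_lt (ν : Measure X) [IsFiniteMeasure ν] {f : X → ℝ}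
    (hf : Integrable f ν) {η : ℝ} (hη : 0 < η) : ∃ g : C(X, ℝ), ∫ x, |f x - g x| ∂ν < η := by
  obtain ⟨g, hg, _⟩ := hf.exists_boundedContinuous_integral_sub_le (half_pos hη)
  exact ⟨g.toContinuousMap, lt_of_le_of_lt hg (half_lt_self hη)⟩

/-- A finite-valued map `ψ` which, as seen by finitely many functions on `Y`, is close to continuous
maps that approximate `φ` in measure. -/
theorem exists_measurable_approx (ν : Measure X) [IsProbabilityMeasure ν] {φ : X → Y}
    (hφ : Measurable φ) (h : ℕ → C(Y, ℝ)) (r : ℕ) {η : ℝ} (hη : 0 < η) :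
    ∃ (ψ : X → Y) (k : ℕ → C(X, ℝ)) (E : C(X, ℝ)), Measurable ψ ∧
      (∀ x, ∀ i < r, |h i (ψ x) - k i x| ≤ E x) ∧ ∫ x, E x ∂ν < η ∧
        ∀ i < r, ∫ x, |h i (φ x) - k i x| ∂ν < η := by
  have hYne : Nonempty Y := by
    obtain ⟨x⟩ : Nonempty X := ν.nonempty_of_neZero
    exact ⟨φ x⟩
  have hint : ∀ i, Integrable (fun x => h i (φ x)) ν := fun i =>
    integrable_of_abs_le ((h i).continuous.measurable.comp hφ) fun x => abs_apply_le_norm (h i) _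
  have hr0 : (0 : ℝ) < 2 * (r + 1) := by positivity
  -- With this tolerance the `r` errors add up to less than `η / 2`; the other half is for the
  -- finite net in `H(Y)`.
  have hk : ∀ i, ∃ g : C(X, ℝ), ∫ x, |h i (φ x) - g x| ∂ν < η / (2 * (r + 1)) := fun i =>
    exists_continuousMap_integral_abs_sub_lt ν (hint i) (by positivity)
  choose k hk using hk
  let H : Y → Fin r → ℝ := fun y i => h i y
  let K : X → Fin r → ℝ := fun x i => k i x
  have hH : Continuous H := by fun_prop
  have hK : Continuous K := by fun_prop
  let y := TopologicalSpace.denseSeq Y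
  obtain ⟨N, hN⟩ : ∃ N, ∀ z, ∃ j ≤ N, dist (H z) (H (y j)) < η / 2 := by
    have hopen : ∀ j, IsOpen {z | dist (H z) (H (y j)) < η / 2} := fun j =>
      isOpen_lt (hH.dist continuous_const) continuous_const
    have hcov : (Set.univ : Set Y) ⊆ ⋃ j, {z | dist (H z) (H (y j)) < η / 2} := by
      intro z _
      have ho : IsOpen {w | dist (H z) (H w) < η / 2} :=
        isOpen_lt (continuous_const.dist hH) continuous_const
      obtain ⟨j, hj⟩ := (TopologicalSpace.denseRange_denseSeq Y).exists_mem_open ho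
        ⟨z, by simp [hη]⟩
      exact Set.mem_iUnion.2 ⟨j, hj⟩
    obtain ⟨t, ht⟩ := isCompact_univ.elim_finite_subcover _ hopen hcov
    refine ⟨t.sup id, fun z => ?_⟩
    obtain ⟨j, hj, hz⟩ := Set.mem_iUnion₂.1 (ht (Set.mem_univ z))
    exact ⟨j, Finset.le_sup (f := id) hj, hz⟩
  let e : ℕ → Fin r → ℝ := fun j => H (y j)
  let A : Set (Fin r → ℝ) := e '' Set.Iic N
  have hA : A.Nonempty := ⟨e 0, 0, Nat.zero_le N, rfl⟩
  -- `ψ x` will be the `y j`, `j ≤ N`, whose image under `H` is nearest to `K x`, so this distance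
  -- bounds its error. Unlike `ψ` it is continuous in `x`, hence its average under `m n` is governed
  -- by weak convergence.
  let E : C(X, ℝ) := ⟨fun x => Metric.infDist (K x) A, by fun_prop⟩
  have hE : ∀ x, E x ≤ ∑ i : Fin r, |h i (φ x) - k i x| + η / 2 := by
    intro x
    obtain ⟨j, hj, hz⟩ := hN (φ x)
    have h1 : E x ≤ dist (K x) (e j) := Metric.infDist_le_dist_of_mem ⟨j, hj, rfl⟩
    have h2 : dist (K x) (H (φ x)) ≤ ∑ i : Fin r, |h i (φ x) - k i x| := by
      refine (dist_pi_le_iff (Finset.sum_nonneg fun _ _ => abs_nonneg _)).2 fun i => ?_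
      rw [dist_comm, Real.dist_eq]
      exact Finset.single_le_sum (f := fun i : Fin r => |h i (φ x) - k i x|)
        (fun _ _ => abs_nonneg _) (Finset.mem_univ i)
    have h3 := dist_triangle (K x) (H (φ x)) (e j)
    have h4 : dist (H (φ x)) (e j) < η / 2 := hz
    linarith
  have hi : ∀ i, Integrable (fun x => |h i (φ x) - k i x|) ν := fun i =>
    ((hint i).sub (integrable_apply ν (k i))).abs
  have hkη : η / (2 * (r + 1)) ≤ η := by
    rw [div_le_iff₀ hr0]
    nlinarith [(Nat.cast_nonneg r : (0 : ℝ) ≤ r)]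
  refine ⟨fun x => y (SimpleFunc.nearestPtInd e N (K x)), k, E, ?_, fun x i hir => ?_, ?_,
    fun i _ => (hk i).trans_le hkη⟩
  · exact measurable_from_top.comp ((SimpleFunc.nearestPtInd e N).measurable.comp hK.measurable)
  · have h1 : dist (e (SimpleFunc.nearestPtInd e N (K x))) (K x) ≤ E x := by
      refine (Metric.le_infDist hA).2 ?_
      rintro _ ⟨j, hj, rfl⟩
      have h2 := SimpleFunc.edist_nearestPt_le e (K x) (Set.mem_Iic.1 hj)
      rw [SimpleFunc.nearestPt, SimpleFunc.map_apply, edist_dist, edist_dist,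
        ENNReal.ofReal_le_ofReal_iff dist_nonneg] at h2
      rwa [dist_comm (K x)]
    refine le_trans ?_ h1
    exact dist_le_pi_dist (e (SimpleFunc.nearestPtInd e N (K x))) (K x) ⟨i, hir⟩
  · have h1 : ∫ x, E x ∂ν ≤ ∑ i : Fin r, ∫ x, |h i (φ x) - k i x| ∂ν + η / 2 := by
      have hs : Integrable (fun x => ∑ i : Fin r, |h i (φ x) - k i x|) ν :=
        integrable_finsetSum _ fun (i : Fin r) _ => hi i
      refine (integral_mono (integrable_apply ν E) (hs.add (integrable_const _)) hE).trans_eq ?_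
      simp only [Pi.add_apply]
      rw [integral_add hs (integrable_const _), integral_finsetSum _ fun (i : Fin r) _ => hi i]
      simp
    have h2 : ∑ i : Fin r, ∫ x, |h i (φ x) - k i x| ∂ν ≤ r * (η / (2 * (r + 1))) := by
      refine (Finset.sum_le_card_nsmul _ _ _ fun (i : Fin r) _ => (hk i).le).trans_eq ?_
      simp
    have h3 : r * (η / (2 * (r + 1))) < η / 2 := by
      rw [← mul_div_assoc, div_lt_div_iff₀ hr0 two_pos]
      nlinarith [(Nat.cast_nonneg r : (0 : ℝ) ≤ r)]
    linarith

end Approximation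

/-! ### Approximating a Borel map along a convergent sequence of models. -/

section Marginal

variable {G : Type*} [Group G] [Countable G] {X Y : Type*} [MetricSpace X] [CompactSpace X]
  [MeasurableSpace X] [BorelSpace X] [MetricSpace Y] [CompactSpace Y] [MeasurableSpace Y]
  [BorelSpace Y] {S : SoficApproximation G} {m : ∀ n, ProbabilityMeasure (S.V n → X)}
  {μ : ProbabilityMeasure (G → X)}

/-- The one-dimensional marginal of a measure on `X^G`. -/
noncomputable def marginal (μ : ProbabilityMeasure (G → X)) : Measure X :=
  (μ : Measure (G → X)).map fun x => x 1

instance (μ : ProbabilityMeasure (G → X)) : IsProbabilityMeasure (marginal μ) :=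
  Measure.isProbabilityMeasure_map (measurable_pi_apply 1).aemeasurable

theorem integral_marginal (hμ : ShiftInvariant μ) (g : G) {f : X → ℝ} (hf : Measurable f) :
    ∫ x, f (x g) ∂(μ : Measure (G → X)) = ∫ x, f x ∂(marginal μ) := by
  rw [marginal, integral_map (measurable_pi_apply 1).aemeasurable hf.aestronglyMeasurable]
  have h1 : Measurable fun x : G → X => f (x 1) := hf.comp (measurable_pi_apply 1)
  have h2 := integral_map (μ := (μ : Measure (G → X))) (hμ g).measurable.aemeasurable
    (f := fun x => f (x 1)) h1.aestronglyMeasurable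
  rw [(hμ g).map_eq] at h2
  simpa using h2.symm

theorem DoublyQuenchedConverges.tendsto_expect_integral (h : DoublyQuenchedConverges S m μ)
    (u : C(X, ℝ)) : Tendsto (fun n => 𝔼 v, ∫ x, u (x v) ∂(m n : Measure (S.V n → X))) atTop
      (𝓝 (∫ x, u x ∂(marginal μ))) := by
  let f : C(G → X, ℝ) := ⟨fun y => u (y 1), by fun_prop⟩
  have e1 : ∫ y, f y ∂(μ : Measure (G → X)) = ∫ x, u x ∂(marginal μ) := by
    rw [marginal, integral_map (measurable_pi_apply 1).aemeasurable
      u.continuous.measurable.aestronglyMeasurable]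
    rfl
  rw [tendsto_iff_dist_tendsto_zero]
  refine squeeze_zero (fun n => dist_nonneg) (fun n => ?_) (h.tendsto_localDeviation f)
  rw [Real.dist_eq, ← e1]
  have e2 : 𝔼 v, ∫ x, u (x v) ∂(m n : Measure (S.V n → X)) =
      𝔼 v, ∫ x, f (pullbackName (S.σ n) v x) ∂(m n : Measure (S.V n → X)) :=
    (expect_perm (S.σ n 1) fun v => ∫ x, u (x v) ∂(m n : Measure (S.V n → X))).symm
  rw [e2]
  exact abs_expect_sub_le _ _

/-- The maps `ψ n` approximate `φ` along `m`: continuous functions of `ψ n` are close, on average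
over vertices, to continuous functions which approximate the same functions of `φ`. -/
def Approximates (S : SoficApproximation G) (m : ∀ n, ProbabilityMeasure (S.V n → X))
    (μ : ProbabilityMeasure (G → X)) (φ : X → Y) (ψ : ℕ → X → Y) : Prop :=
  ∀ (w : C(Y, ℝ)) (η : ℝ), 0 < η → ∃ u : C(X, ℝ), ∫ x, |w (φ x) - u x| ∂(marginal μ) < η ∧
    ∀ᶠ n in atTop, 𝔼 v, ∫ x, |w (ψ n (x v)) - u (x v)| ∂(m n : Measure (S.V n → X)) < η

theorem integrable_comp_sub {A B Z : Type*} [TopologicalSpace A] [CompactSpace A]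
    [MeasurableSpace A] [OpensMeasurableSpace A] [TopologicalSpace B] [CompactSpace B]
    [MeasurableSpace B] [OpensMeasurableSpace B] [MeasurableSpace Z] (ν : Measure Z)
    [IsFiniteMeasure ν] {a : Z → A} {b : Z → B} (ha : Measurable a) (hb : Measurable b)
    (w : C(A, ℝ)) (u : C(B, ℝ)) :
    Integrable (fun z => |w (a z) - u (b z)|) ν :=
  ((integrable_of_abs_le (w.continuous.measurable.comp ha) fun _ => abs_apply_le_norm w _).sub
    (integrable_of_abs_le (u.continuous.measurable.comp hb) fun _ => abs_apply_le_norm u _)).abs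

theorem expect_integral_abs_sub_le {V : Type} [Fintype V] (m : Measure (V → X)) [IsFiniteMeasure m]
    {ψ : X → Y} (hψ : Measurable ψ) {w : C(Y, ℝ)} {k u : C(X, ℝ)}
    (hu : ∀ x, |w (ψ x) - k x| ≤ u x) :
    𝔼 v, ∫ x, |w (ψ (x v)) - k (x v)| ∂m ≤ 𝔼 v, ∫ x, u (x v) ∂m := by
  refine expect_mono fun v => ?_
  have h1 : Integrable (fun x : V → X => |w (ψ (x v)) - k (x v)|) m :=
    integrable_comp_sub (a := fun x : V → X => ψ (x v)) (b := fun x : V → X => x v) m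
      (hψ.comp (measurable_pi_apply v)) (measurable_pi_apply v) w k
  have h2 : Integrable (fun x : V → X => u (x v)) m :=
    integrable_apply m ⟨fun x : V → X => u (x v), by fun_prop⟩
  exact integral_mono h1 h2 fun x => hu (x v)

theorem integral_abs_sub_le_add {Z : Type*} [MeasurableSpace Z] (ν : Measure Z)
    [IsProbabilityMeasure ν] {a : Z → Y} {b : Z → X} (ha : Measurable a) (hb : Measurable b)
    {w w' : C(Y, ℝ)} {c : ℝ} (hw : ∀ y, |w y - w' y| ≤ c) (u : C(X, ℝ)) :
    ∫ z, |w (a z) - u (b z)| ∂ν ≤ c + ∫ z, |w' (a z) - u (b z)| ∂ν := by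
  have h1 := integrable_comp_sub ν ha hb w u
  have h2 := integrable_comp_sub ν ha hb w' u
  have h3 : ∫ z, |w (a z) - u (b z)| ∂ν ≤ ∫ z, (c + |w' (a z) - u (b z)|) ∂ν :=
    integral_mono h1 ((integrable_const _).add h2) fun z =>
      (abs_sub_le _ (w' (a z)) _).trans (add_le_add_left (hw _) _)
  rw [integral_add (integrable_const _) h2] at h3
  simpa using h3

/-- For fixed `r` the error of `ψ r` is dominated by a continuous function of small `μ`-mean, so it
is small under `m n` for large `n`. Letting `r = ρ n` grow slowly keeps these bounds for every
earlier stage `r'`. The comparison functions `k r' i` stay fixed, as `Approximates` requires. -/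
theorem DoublyQuenchedConverges.exists_approximates (h : DoublyQuenchedConverges S m μ) {φ : X → Y}
    (hφ : Measurable φ) : ∃ ψ : ℕ → X → Y, (∀ n, Measurable (ψ n)) ∧ Approximates S m μ φ ψ := by
  obtain ⟨hd, hdense⟩ : ∃ hd : ℕ → C(Y, ℝ), DenseRange hd :=
    ⟨_, TopologicalSpace.denseRange_denseSeq C(Y, ℝ)⟩
  have hpos : ∀ r : ℕ, (0 : ℝ) < 1 / (r + 1) := fun r => by positivity
  choose ψ k E hψ hE hE2 hk using fun r =>
    exists_measurable_approx (marginal μ) hφ hd r (hpos r)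
  -- Three errors below `1 / (r' + 1)`: the bound `E r`, and the distances of `k r i` and `k r' i`
  -- from `hd i ∘ φ`.
  have hP : ∀ r, ∀ᶠ n in atTop, ∀ r' ∈ Finset.range (r + 1), ∀ i ∈ Finset.range r',
      𝔼 v, ∫ x, |hd i (ψ r (x v)) - k r' i (x v)| ∂(m n : Measure (S.V n → X)) < 3 / (r' + 1) := by
    intro r
    rw [Finset.eventually_all]
    intro r' hr'
    rw [Finset.eventually_all]
    intro i hi
    rw [Finset.mem_range] at hi hr'
    let u : C(X, ℝ) := ⟨fun x => E r x + |k r i x - k r' i x|, by fun_prop⟩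
    have hu : ∀ x, |hd i (ψ r x) - k r' i x| ≤ u x := fun x =>
      (abs_sub_le _ (k r i x) _).trans (add_le_add_left (hE r x i (by omega)) _)
    have hint : ∫ x, u x ∂(marginal μ) < 3 / (r' + 1) := by
      have i1 := integrable_comp_sub (marginal μ) hφ measurable_id (hd i) (k r i)
      have i2 := integrable_comp_sub (marginal μ) hφ measurable_id (hd i) (k r' i)
      have h1 : ∫ x, u x ∂(marginal μ) ≤ ∫ x, E r x ∂(marginal μ) +
          (∫ x, |hd i (φ x) - k r i x| ∂(marginal μ) +
            ∫ x, |hd i (φ x) - k r' i x| ∂(marginal μ)) := by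
        have i3 : Integrable (fun x => |hd i (φ x) - k r i x| + |hd i (φ x) - k r' i x|)
          (marginal μ) := i1.add i2
        rw [← integral_add (f := fun x => |hd i (φ x) - k r i x|)
            (g := fun x => |hd i (φ x) - k r' i x|) i1 i2,
          ← integral_add (integrable_apply _ (E r)) i3]
        refine integral_mono (integrable_apply _ u) ((integrable_apply _ (E r)).add i3) fun x => ?_
        refine add_le_add_right ?_ _
        rw [abs_sub_comm (hd i (φ x)) (k r i x)]
        exact abs_sub_le _ _ _
      have h2 : (1 : ℝ) / (r + 1) ≤ 1 / (r' + 1) := by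
        have : (r' : ℝ) ≤ r := by exact_mod_cast (by omega : r' ≤ r)
        gcongr
      have h3 : (3 : ℝ) / (r' + 1) = 1 / (r' + 1) + (1 / (r' + 1) + 1 / (r' + 1)) := by ring
      have := hE2 r
      have := hk r i (by omega)
      have := hk r' i hi
      linarith
    filter_upwards [(h.tendsto_expect_integral u).eventually_lt_const hint] with n hn
    exact lt_of_le_of_lt (expect_integral_abs_sub_le (m n : Measure (S.V n → X)) (hψ r) hu) hn
  obtain ⟨ρ, hρ, hρP⟩ := exists_tendsto_eventually_of_forall hP
  refine ⟨fun n => ψ (ρ n), fun n => hψ _, fun w η hη => ?_⟩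
  obtain ⟨i, hi⟩ := Metric.denseRange_iff.1 hdense w (η / 4)
    (by positivity)
  obtain ⟨r₀, hr₀⟩ := exists_nat_gt (6 / η)
  let r' := max (i + 1) r₀
  have hr' : (3 : ℝ) / (r' + 1) < η / 2 := by
    have h1 : (r₀ : ℝ) ≤ r' := by exact_mod_cast le_max_right _ _
    rw [div_lt_div_iff₀ (by positivity) two_pos]
    rw [div_lt_iff₀ hη] at hr₀
    nlinarith
  have hir : i < r' := lt_of_lt_of_le (Nat.lt_succ_self i) (le_max_left _ _)
  have hwi : ∀ y, |w y - hd i y| ≤ η / 4 := fun y => (ContinuousMap.dist_apply_le_dist y).trans hi.le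
  refine ⟨k r' i, ?_, ?_⟩
  · have h1 := integral_abs_sub_le_add (marginal μ) hφ measurable_id hwi (k r' i)
    have h2 := hk r' i hir
    have h3 : (3 : ℝ) / (r' + 1) = 3 * (1 / (r' + 1)) := by ring
    have h4 := hpos r'
    simp only [id] at h1
    linarith
  · filter_upwards [hρ.eventually_ge_atTop r', hρP] with n hn1 hn2
    have h1 := hn2 r' (Finset.mem_range.2 (by omega)) i (Finset.mem_range.2 hir)
    have h2 : 𝔼 v, ∫ x, |w (ψ (ρ n) (x v)) - k r' i (x v)| ∂(m n : Measure (S.V n → X)) ≤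
        𝔼 v, (η / 4 + ∫ x, |hd i (ψ (ρ n) (x v)) - k r' i (x v)| ∂(m n : Measure (S.V n → X))) :=
      expect_mono fun v => integral_abs_sub_le_add (a := fun x : S.V n → X => ψ (ρ n) (x v))
        (b := fun x : S.V n → X => x v) (m n : Measure (S.V n → X))
        ((hψ (ρ n)).comp (measurable_pi_apply v)) (measurable_pi_apply v) hwi (k r' i)
    rw [Finset.expect_add_distrib, Fintype.expect_const] at h2
    linarith

end Marginal

theorem abs_mul_sub_mul_le {a b c d : ℝ} (hb : |b| ≤ 1) (hc : |c| ≤ 1) :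
    |a * b - c * d| ≤ |a - c| + |b - d| := by
  have h : a * b - c * d = (a - c) * b + c * (b - d) := by ring
  rw [h]
  refine (abs_add_le _ _).trans (add_le_add ?_ ?_)
  · rw [abs_mul]; exact mul_le_of_le_one_right (abs_nonneg _) hb
  · rw [abs_mul]; exact mul_le_of_le_one_left (abs_nonneg _) hc

/-! ### Decorrelation of the approximate images. -/

section Transfer

variable {G : Type*} [Group G] [Countable G] {X Y : Type*} [MetricSpace X] [CompactSpace X]
  [MeasurableSpace X] [BorelSpace X] [MetricSpace Y] [CompactSpace Y] [MeasurableSpace Y]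
  [BorelSpace Y] {S : SoficApproximation G} {m : ∀ n, ProbabilityMeasure (S.V n → X)}
  {μ : ProbabilityMeasure (G → X)} {φ : X → Y} {ψ : ℕ → X → Y}

theorem integral_abs_mul_sub_mul_le {A B Z : Type*} [TopologicalSpace A] [CompactSpace A]
    [MeasurableSpace A] [OpensMeasurableSpace A] [TopologicalSpace B] [CompactSpace B]
    [MeasurableSpace B] [OpensMeasurableSpace B] [MeasurableSpace Z] (ν : Measure Z)
    [IsFiniteMeasure ν] {a a' : Z → A} {b b' : Z → B} (ha : Measurable a) (ha' : Measurable a')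
    (hb : Measurable b) (hb' : Measurable b') {f f' : C(A, ℝ)} {u u' : C(B, ℝ)}
    (hf' : ∀ y, |f' y| ≤ 1) (hu : ∀ x, |u x| ≤ 1) :
    ∫ z, |f (a z) * f' (a' z) - u (b z) * u' (b' z)| ∂ν ≤
      ∫ z, |f (a z) - u (b z)| ∂ν + ∫ z, |f' (a' z) - u' (b' z)| ∂ν := by
  have i1 := integrable_comp_sub ν ha hb f u
  have i2 := integrable_comp_sub ν ha' hb' f' u'
  rw [← integral_add i1 i2]
  refine integral_mono_of_nonneg (Eventually.of_forall fun _ => abs_nonneg _) (i1.add i2)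
    (Eventually.of_forall fun z => ?_)
  exact abs_mul_sub_mul_le (hf' _) (hu _)

/-- The functions on `Y^G` with values in `[-1, 1]` whose images under `φ` and `ψ` admit common
continuous approximants. -/
def approximable (S : SoficApproximation G) (m : ∀ n, ProbabilityMeasure (S.V n → X))
    (μ : ProbabilityMeasure (G → X)) {φ : X → Y} {ψ : ℕ → X → Y} (hφ : Measurable φ)
    (hψ : ∀ n, Measurable (ψ n)) : Submonoid C(G → Y, ℝ) where
  carrier := {f | (∀ y, |f y| ≤ 1) ∧ ∀ η : ℝ, 0 < η → ∃ u : C(G → X, ℝ), (∀ x, |u x| ≤ 1) ∧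
    ∫ x, |f (fun i => φ (x i)) - u x| ∂(μ : Measure (G → X)) < η ∧
      ∀ᶠ n in atTop, 𝔼 v, ∫ x, |f (pullbackName (S.σ n) v fun i => ψ n (x i)) -
        u (pullbackName (S.σ n) v x)| ∂(m n : Measure (S.V n → X)) < η}
  one_mem' := by
    refine ⟨fun y => by simp, fun η hη => ⟨1, fun x => by simp, by simpa using hη,
      Eventually.of_forall fun n => by simpa using hη⟩⟩
  mul_mem' := by
    rintro f f' ⟨hf, hfu⟩ ⟨hf', hfu'⟩
    refine ⟨fun y => ?_, fun η hη => ?_⟩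
    · rw [ContinuousMap.mul_apply, abs_mul]
      exact mul_le_one₀ (hf y) (abs_nonneg _) (hf' y)
    · obtain ⟨u, hu, hu1, hu2⟩ := hfu (η / 2) (half_pos hη)
      obtain ⟨u', hu', hu1', hu2'⟩ := hfu' (η / 2) (half_pos hη)
      refine ⟨u * u', fun x => ?_, ?_, ?_⟩
      · rw [ContinuousMap.mul_apply, abs_mul]
        exact mul_le_one₀ (hu x) (abs_nonneg _) (hu' x)
      · have hm := measurable_comp_left (I := G) hφ
        have := integral_abs_mul_sub_mul_le (μ : Measure (G → X)) hm hm measurable_id measurable_id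
          (f := f) (f' := f') (u := u) (u' := u') hf' hu
        simp only [id] at this
        simp only [ContinuousMap.mul_apply]
        linarith
      · filter_upwards [hu2, hu2'] with n hn hn'
        have h1 : ∀ v, ∫ x, |(f * f') (pullbackName (S.σ n) v fun i => ψ n (x i)) -
            (u * u') (pullbackName (S.σ n) v x)| ∂(m n : Measure (S.V n → X)) ≤
            ∫ x, |f (pullbackName (S.σ n) v fun i => ψ n (x i)) -
              u (pullbackName (S.σ n) v x)| ∂(m n : Measure (S.V n → X)) +
            ∫ x, |f' (pullbackName (S.σ n) v fun i => ψ n (x i)) -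
              u' (pullbackName (S.σ n) v x)| ∂(m n : Measure (S.V n → X)) := by
          intro v
          have hm : Measurable fun x : S.V n → X => pullbackName (S.σ n) v fun i => ψ n (x i) :=
            (measurable_pullbackName (S.σ n) v).comp (measurable_comp_left (hψ n))
          exact integral_abs_mul_sub_mul_le (m n : Measure (S.V n → X)) hm hm
            (measurable_pullbackName (S.σ n) v) (measurable_pullbackName (S.σ n) v) hf' hu
        refine (expect_mono h1).trans_lt ?_
        rw [Finset.expect_add_distrib]
        linarith

/-- Truncation to `[-1, 1]` does not increase the distance to points of `[-1, 1]`. The bound by `1`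
is what makes `approximable` closed under products. -/
theorem exists_clip (u : C(X, ℝ)) : ∃ u' : C(X, ℝ), (∀ x, |u' x| ≤ 1) ∧
    ∀ (c : ℝ) (x : X), |c| ≤ 1 → |c - u' x| ≤ |c - u x| := by
  refine ⟨⟨fun x => max (-1) (min 1 (u x)), by fun_prop⟩, fun x => ?_, fun c x hc => ?_⟩
  · exact abs_le.2 ⟨le_max_left _ _, max_le (by norm_num) (min_le_left _ _)⟩
  · have hc' := abs_le.1 hc
    have h1 : c = max (-1) (min 1 c) := by
      rw [min_eq_right hc'.2, max_eq_right hc'.1]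
    change |c - max (-1) (min 1 (u x))| ≤ _
    conv_lhs => rw [h1]
    refine (abs_max_sub_max_le_max _ _ _ _).trans ?_
    rw [sub_self, abs_zero]
    refine max_le (abs_nonneg _) ((abs_min_sub_min_le_max _ _ _ _).trans ?_)
    rw [sub_self, abs_zero]
    exact max_le (abs_nonneg _) le_rfl

/-- On the side of `μ`, shift-invariance moves the coordinate `g` to the identity; on the side of
the models, `S.σ n g` permutes the vertices and drops out of the average. -/
theorem Approximates.mem_approximable (h : Approximates S m μ φ ψ) (hμ : ShiftInvariant μ)
    (hφ : Measurable φ) (hψ : ∀ n, Measurable (ψ n)) (g : G) (w : C(Y, ℝ)) (hw : ∀ y, |w y| ≤ 1) :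
    (⟨fun y => w (y g), by fun_prop⟩ : C(G → Y, ℝ)) ∈ approximable S m μ hφ hψ := by
  refine ⟨fun y => hw _, fun η hη => ?_⟩
  obtain ⟨u, hu1, hu2⟩ := h w η hη
  obtain ⟨u', hu'1, hu'⟩ := exists_clip u
  refine ⟨⟨fun x => u' (x g), by fun_prop⟩, fun x => hu'1 _, ?_, ?_⟩
  · refine lt_of_le_of_lt ?_ hu1
    have hm : Measurable fun x => |w (φ x) - u' x| :=
      ((w.continuous.measurable.comp hφ).sub u'.continuous.measurable).abs
    have h1 := integral_marginal hμ g hm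
    refine (le_of_eq h1).trans ?_
    exact integral_mono (integrable_comp_sub _ hφ measurable_id w u')
      (integrable_comp_sub _ hφ measurable_id w u) fun x => hu' _ x (hw _)
  · filter_upwards [hu2] with n hn
    refine lt_of_le_of_lt ?_ hn
    have h1 := expect_perm (S.σ n g) fun v =>
      ∫ x, |w (ψ n (x v)) - u' (x v)| ∂(m n : Measure (S.V n → X))
    refine (le_of_eq h1).trans (expect_mono fun v => ?_)
    have hm : Measurable fun x : S.V n → X => ψ n (x v) := (hψ n).comp (measurable_pi_apply v)
    exact integral_mono (integrable_comp_sub _ hm (measurable_pi_apply v) w u')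
      (integrable_comp_sub _ hm (measurable_pi_apply v) w u) fun x => hu' _ _ (hw _)

theorem abs_integral_sub_integral_le {Z : Type*} [MeasurableSpace Z] {ν : Measure Z} {a b : Z → ℝ}
    (ha : Integrable a ν) (hb : Integrable b ν) :
    |∫ z, a z ∂ν - ∫ z, b z ∂ν| ≤ ∫ z, |a z - b z| ∂ν := by
  rw [← integral_sub ha hb]
  exact abs_integral_le_integral_abs

/-- The approximable functions form a multiplicative family separating points. On it the
decorrelation error under `ψ n` is compared with that of continuous functions `u`, `u'` on `X^G`,
where the hypothesis applies. -/
theorem DoublyQuenchedConverges.map_approximates (h : DoublyQuenchedConverges S m μ)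
    (hμ : ShiftInvariant μ) (hφ : Measurable φ) (hψ : ∀ n, Measurable (ψ n))
    (hψφ : Approximates S m μ φ ψ) :
    DoublyQuenchedConverges S (fun n => mapCoord (hψ n) (m n)) (mapCoord hφ μ) := by
  refine doublyQuenchedConverges_of_submonoid (approximable S m μ hφ hψ) (fun x y hxy => ?_) ?_
  · obtain ⟨g, hg⟩ := Function.ne_iff.1 hxy
    let w : C(Y, ℝ) := ⟨fun z => min 1 (dist z (x g)), by fun_prop⟩
    refine ⟨_, hψφ.mem_approximable hμ hφ hψ g w fun z => ?_, ?_⟩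
    · change |min 1 (dist z (x g))| ≤ 1
      rw [abs_of_nonneg (le_min zero_le_one dist_nonneg)]
      exact min_le_left _ _
    · have : (0 : ℝ) < min 1 (dist (y g) (x g)) := lt_min zero_lt_one (dist_pos.2 (Ne.symm hg))
      simpa [w] using this.ne
  · rintro f ⟨hf, hfu⟩ f' ⟨hf', hfu'⟩
    rw [Metric.tendsto_nhds]
    intro ε hε
    -- Five errors: replacing each of `f`, `f'` by its approximant under `m n` and under `μ`, and
    -- the pair deviation of `u`, `u'`.
    obtain ⟨u, hu, hu1, hu2⟩ := hfu (ε / 5) (by positivity)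
    obtain ⟨u', hu', hu1', hu2'⟩ := hfu' (ε / 5) (by positivity)
    filter_upwards [hu2, hu2', (h.tendsto_pairDeviation u u').eventually_lt_const
      (show 0 < ε / 5 by positivity)] with n h1 h2 h3
    rw [Real.dist_eq, sub_zero, abs_of_nonneg (pairDeviation_nonneg _ _ _ _ _ _)]
    set a := ∫ y, f y ∂(mapCoord hφ μ : Measure (G → Y)) with ha
    set a' := ∫ y, f' y ∂(mapCoord hφ μ : Measure (G → Y)) with ha'
    set b := ∫ x, u x ∂(μ : Measure (G → X)) with hb
    set b' := ∫ x, u' x ∂(μ : Measure (G → X)) with hb'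
    have hmφ := measurable_comp_left (I := G) hφ
    have e1 : |a - b| < ε / 5 := by
      rw [ha, integral_mapCoord hφ μ f.continuous.measurable]
      exact (abs_integral_sub_integral_le (integrable_of_abs_le
        (f.continuous.measurable.comp hmφ) fun _ => hf _) (integrable_apply _ u)).trans_lt hu1
    have e2 : |a' - b'| < ε / 5 := by
      rw [ha', integral_mapCoord hφ μ f'.continuous.measurable]
      exact (abs_integral_sub_integral_le (integrable_of_abs_le
        (f'.continuous.measurable.comp hmφ) fun _ => hf' _) (integrable_apply _ u')).trans_lt hu1'
    have e3 : |b * b' - a * a'| ≤ |a - b| + |a' - b'| := by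
      rw [abs_sub_comm a b, abs_sub_comm a' b']
      exact abs_mul_sub_mul_le (abs_integral_le_of_abs_le hu') (abs_integral_le_of_abs_le hf)
    set p : S.V n → ℝ := fun v => ∫ x, |f (pullbackName (S.σ n) v fun i => ψ n (x i)) -
      u (pullbackName (S.σ n) v x)| ∂(m n : Measure (S.V n → X)) with hp
    set p' : S.V n → ℝ := fun v => ∫ x, |f' (pullbackName (S.σ n) v fun i => ψ n (x i)) -
      u' (pullbackName (S.σ n) v x)| ∂(m n : Measure (S.V n → X)) with hp'
    have key : pairDeviation S (fun n => mapCoord (hψ n) (m n)) (mapCoord hφ μ) f f' n ≤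
        𝔼 v, 𝔼 w, (|∫ x, u (pullbackName (S.σ n) v x) * u' (pullbackName (S.σ n) w x)
          ∂(m n : Measure (S.V n → X)) - b * b'| + p v + p' w + (|a - b| + |a' - b'|)) := by
      refine expect_mono fun v => expect_mono fun w => ?_
      have hm : ∀ v, Measurable fun x : S.V n → X => pullbackName (S.σ n) v fun i => ψ n (x i) :=
        fun v => (measurable_pullbackName (S.σ n) v).comp (measurable_comp_left (hψ n))
      have hmf : Measurable fun y : S.V n → Y =>
          f (pullbackName (S.σ n) v y) * f' (pullbackName (S.σ n) w y) :=
        (measurable_apply_pullbackName f _ v).mul (measurable_apply_pullbackName f' _ w)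
      rw [integral_mapCoord (hψ n) (m n) hmf]
      have i1 : Integrable (fun x : S.V n → X => f (pullbackName (S.σ n) v fun i => ψ n (x i)) *
          f' (pullbackName (S.σ n) w fun i => ψ n (x i))) (m n : Measure (S.V n → X)) :=
        integrable_of_abs_le (hmf.comp (measurable_comp_left (hψ n))) (C := 1) fun x => by
          simp only [abs_mul]
          exact mul_le_one₀ (hf _) (abs_nonneg _) (hf' _)
      have e4 := abs_integral_sub_integral_le i1
        (integrable_mul_pullbackName u u' (S.σ n) v w (m n : Measure (S.V n → X)))
      have e5 := integral_abs_mul_sub_mul_le (m n : Measure (S.V n → X)) (hm v) (hm w)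
        (measurable_pullbackName (S.σ n) v) (measurable_pullbackName (S.σ n) w)
        (f := f) (f' := f') (u := u) (u' := u') hf' hu
      have e6 := abs_sub_le (∫ x, f (pullbackName (S.σ n) v fun i => ψ n (x i)) *
          f' (pullbackName (S.σ n) w fun i => ψ n (x i)) ∂(m n : Measure (S.V n → X)))
        (∫ x, u (pullbackName (S.σ n) v x) * u' (pullbackName (S.σ n) w x)
          ∂(m n : Measure (S.V n → X))) (a * a')
      have e7 := abs_sub_le (∫ x, u (pullbackName (S.σ n) v x) * u' (pullbackName (S.σ n) w x)
          ∂(m n : Measure (S.V n → X))) (b * b') (a * a')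
      change |_ - a * a'| ≤ _
      linarith
    simp only [Finset.expect_add_distrib, Fintype.expect_const] at key
    have h4 : pairDeviation S m μ u u' n =
      𝔼 v, 𝔼 w, |∫ x, u (pullbackName (S.σ n) v x) * u' (pullbackName (S.σ n) w x)
          ∂(m n : Measure (S.V n → X)) - b * b'| := rfl
    linarith

end Transfer

/-! ### Comparison of covering numbers and transfer of entropy. -/

section Compare

variable {X Y : Type*} [MetricSpace X] [CompactSpace X]
  [MeasurableSpace X] [BorelSpace X] [MetricSpace Y] [CompactSpace Y] [MeasurableSpace Y]
  [BorelSpace Y]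

/-- Each centre for the image, if it is `δ'`-close to the image of a point of `A`, is replaced by
such a point. Two points of `A` near the same centre have images within `2 δ'`; half of `ε` pays for
`Aᶜ`. -/
theorem covNum_le_of_modulus {V : Type} [Fintype V] [Nonempty V] (m : ProbabilityMeasure (V → X))
    {ψ : X → Y} (hψ : Measurable ψ) {ε δ δ' : ℝ} {A : Set (V → X)}
    (hA : (m : Measure (V → X)).real Aᶜ < ε / 2)
    (hAψ : ∀ x ∈ A, ∀ y ∈ A, hammingAvg (fun v => ψ (x v)) (fun v => ψ (y v)) < 2 * δ' →
      hammingAvg x y < δ) :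
    covNum ε δ m ≤ covNum (ε / 2) δ' (mapCoord hψ m) := by
  classical
  refine le_iInf₂ fun F hF => ?_
  obtain ⟨x₀⟩ : Nonempty (V → X) := (m : Measure (V → X)).nonempty_of_neZero
  have hch : ∀ z : V → Y, ∃ x : V → X, (∃ y ∈ A, hammingAvg z (fun v => ψ (y v)) < δ') →
      x ∈ A ∧ hammingAvg z (fun v => ψ (x v)) < δ' := by
    intro z
    by_cases h : ∃ y ∈ A, hammingAvg z (fun v => ψ (y v)) < δ'
    · obtain ⟨y, hy⟩ := h
      exact ⟨y, fun _ => hy⟩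
    · exact ⟨x₀, fun h' => absurd h' h⟩
  choose c hc using hch
  refine le_trans (covNum_le_card (F := F.image c) ?_) (by exact_mod_cast Finset.card_image_le)
  rw [mapCoord, ProbabilityMeasure.toMeasure_map, map_measureReal_apply (measurable_comp_left hψ)
    (isOpen_setOf_exists_hammingAvg_lt F δ').measurableSet] at hF
  have hsub : (fun (x : V → X) (i : V) => ψ (x i)) ⁻¹' {y | ∃ x ∈ F, hammingAvg x y < δ'} ⊆
      {y | ∃ x ∈ F.image c, hammingAvg x y < δ} ∪ Aᶜ := by
    rintro y ⟨z, hz, hzy⟩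
    by_cases hy : y ∈ A
    · obtain ⟨h1, h2⟩ := hc z ⟨y, hy, hzy⟩
      refine Or.inl ⟨c z, Finset.mem_image_of_mem c hz, hAψ _ h1 _ hy ?_⟩
      have h3 := hammingAvg_triangle (fun v => ψ (c z v)) z fun v => ψ (y v)
      rw [hammingAvg_comm _ z] at h3
      linarith
    · exact Or.inr hy
  have h1 := (measureReal_mono hsub).trans (measureReal_union_le (μ := (m : Measure (V → X))) _ _)
  linarith

/-- Uniform continuity in affine form, which survives averaging over vertices and so applies to
Hamming averages. -/
theorem exists_modulus (w : C(Y, ℝ)) {κ : ℝ} (hκ : 0 < κ) :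
    ∃ C : ℝ, 0 ≤ C ∧ ∀ a b, |w a - w b| ≤ κ + C * dist a b := by
  obtain ⟨δ, hδ, h⟩ := Metric.uniformContinuous_iff.1
    (CompactSpace.uniformContinuous_of_continuous w.continuous) κ hκ
  refine ⟨2 * ‖w‖ / δ, by positivity, fun a b => ?_⟩
  by_cases hab : dist a b < δ
  · have h1 := (h hab).le
    rw [Real.dist_eq] at h1
    have : 0 ≤ 2 * ‖w‖ / δ * dist a b := by positivity
    linarith
  · have h1 : |w a - w b| ≤ 2 * ‖w‖ := by
      rw [two_mul]
      exact (abs_sub _ _).trans (add_le_add (abs_apply_le_norm w a) (abs_apply_le_norm w b))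
    have h2 : 2 * ‖w‖ ≤ 2 * ‖w‖ / δ * dist a b := by
      rw [div_mul_eq_mul_div, le_div_iff₀ hδ]
      exact mul_le_mul_of_nonneg_left (not_lt.1 hab) (by positivity)
    linarith

theorem exists_finset_net (X : Type*) [MetricSpace X] [CompactSpace X] {η : ℝ} (hη : 0 < η) :
    ∃ Z : Finset X, ∀ x, ∃ z ∈ Z, dist x z < η := by
  obtain ⟨t, ht⟩ := isCompact_univ.elim_finite_subcover (fun z : X => Metric.ball z η)
    (fun _ => Metric.isOpen_ball) fun x _ => Set.mem_iUnion.2 ⟨x, Metric.mem_ball_self hη⟩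
  refine ⟨t, fun x => ?_⟩
  obtain ⟨z, hz, hx⟩ := Set.mem_iUnion₂.1 (ht (Set.mem_univ x))
  exact ⟨z, hz, hx⟩

/-- Reduces control of the metric to finitely many continuous functions, the distances to a net. -/
theorem dist_le_add_sum_abs {Z : Finset X} {η : ℝ} (hZ : ∀ x, ∃ z ∈ Z, dist x z < η) (x y : X) :
    dist x y ≤ 2 * η + ∑ z ∈ Z, |dist x z - dist y z| := by
  obtain ⟨z, hz, hxz⟩ := hZ x
  have h1 := Finset.single_le_sum (f := fun z => |dist x z - dist y z|)
    (fun _ _ => abs_nonneg _) hz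
  have h2 := dist_triangle_right x y z
  have h3 := neg_abs_le (dist x z - dist y z)
  linarith

variable {G : Type*} [Group G] [Countable G] {S : SoficApproximation G}
  {m : ∀ n, ProbabilityMeasure (S.V n → X)} {μ : ProbabilityMeasure (G → X)} {ψ : ℕ → X → Y}

/-- Here invertibility of `φ` enters: `u ∘ φ⁻¹` is approximated in mean by a continuous `w` on `Y`,
so `u` is nearly `w ∘ φ`. The function `u'` that `Approximates` assigns to `w` is then close to `u`
in mean, and `|u' - u|` is continuous, so this persists under `m n`. -/
theorem DoublyQuenchedConverges.exists_approx_comp (h : DoublyQuenchedConverges S m μ) (φ : X ≃ᵐ Y)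
    (hψ : ∀ n, Measurable (ψ n)) (hψφ : Approximates S m μ φ ψ) (u : C(X, ℝ)) {θ : ℝ}
    (hθ : 0 < θ) : ∃ w : C(Y, ℝ), ∀ᶠ n in atTop,
      𝔼 v, ∫ x, |w (ψ n (x v)) - u (x v)| ∂(m n : Measure (S.V n → X)) < θ := by
  have hint : Integrable (fun y => u (φ.symm y)) ((marginal μ).map φ) :=
    integrable_of_abs_le (u.continuous.measurable.comp φ.symm.measurable) fun _ => abs_apply_le_norm u _
  have : IsProbabilityMeasure ((marginal μ).map φ) :=
    Measure.isProbabilityMeasure_map φ.measurable.aemeasurable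
  obtain ⟨w, hw⟩ := exists_continuousMap_integral_abs_sub_lt ((marginal μ).map φ) hint
    (show 0 < θ / 4 by positivity)
  rw [integral_map_equiv] at hw
  simp only [MeasurableEquiv.symm_apply_apply] at hw
  obtain ⟨u', hu1, hu2⟩ := hψφ w (θ / 4) (by positivity)
  refine ⟨w, ?_⟩
  let d : C(X, ℝ) := ⟨fun x => |u' x - u x|, by fun_prop⟩
  have hd : ∫ x, d x ∂(marginal μ) < θ / 2 := by
    have i1 := integrable_comp_sub (marginal μ) φ.measurable measurable_id w u'
    have i2 := integrable_comp_sub (marginal μ) measurable_id φ.measurable u w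
    have h1 : ∫ x, d x ∂(marginal μ) ≤
        ∫ x, (|w (φ x) - u' x| + |u x - w (φ x)|) ∂(marginal μ) := by
      refine integral_mono (integrable_apply _ d) (i1.add i2) fun x => ?_
      change |u' x - u x| ≤ |w (φ x) - u' x| + |u x - w (φ x)|
      rw [abs_sub_comm (w (φ x)), abs_sub_comm (u x)]
      exact abs_sub_le _ _ _
    have h2 := integral_add i1 i2
    simp only [id] at h2
    linarith
  filter_upwards [hu2, (h.tendsto_expect_integral d).eventually_lt_const hd] with n h1 h2
  have h3 : 𝔼 v, ∫ x, |w (ψ n (x v)) - u (x v)| ∂(m n : Measure (S.V n → X)) ≤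
      𝔼 v, (∫ x, |w (ψ n (x v)) - u' (x v)| ∂(m n : Measure (S.V n → X)) +
        ∫ x, d (x v) ∂(m n : Measure (S.V n → X))) := by
    refine expect_mono fun v => ?_
    have hm : Measurable fun x : S.V n → X => ψ n (x v) := (hψ n).comp (measurable_pi_apply v)
    have i1 := integrable_comp_sub (m n : Measure (S.V n → X)) hm (measurable_pi_apply v) w u'
    have i2 : Integrable (fun x : S.V n → X => d (x v)) (m n : Measure (S.V n → X)) :=
      integrable_apply _ ⟨fun x : S.V n → X => d (x v), by fun_prop⟩
    rw [← integral_add i1 i2]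
    exact integral_mono (integrable_comp_sub (m n : Measure (S.V n → X)) hm (measurable_pi_apply v) w u)
      (i1.add i2) fun x => abs_sub_le _ _ _
  rw [Finset.expect_add_distrib] at h3
  linarith

theorem DoublyQuenchedConverges.eventually_covNum_le (h : DoublyQuenchedConverges S m μ)
    (φ : X ≃ᵐ Y) (hψ : ∀ n, Measurable (ψ n)) (hψφ : Approximates S m μ φ ψ) {ε δ : ℝ}
    (hε : 0 < ε) (hδ : 0 < δ) : ∃ δ' : ℝ, 0 < δ' ∧ ∀ᶠ n in atTop,
      covNum ε δ (m n) ≤ covNum (ε / 2) δ' (mapCoord (hψ n) (m n)) := by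
  obtain ⟨Z, hZ⟩ := exists_finset_net X (show 0 < δ / 16 by positivity)
  -- The added `1`, here and in `K`, keeps the denominators positive.
  set r : ℝ := Z.card + 1 with hr
  have hr0 : 0 < r := by positivity
  have hch := fun z : X => h.exists_approx_comp φ hψ hψφ ⟨fun x => dist x z, by fun_prop⟩
    (show 0 < δ * ε / (16 * r) by positivity)
  choose w hw using hch
  choose C hC0 hC using fun z => exists_modulus (w z) (show 0 < δ / (16 * r) by positivity)
  set K : ℝ := ∑ z ∈ Z, C z + 1 with hK
  have hCs : 0 ≤ ∑ z ∈ Z, C z := Finset.sum_nonneg fun z _ => hC0 z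
  have hK0 : 0 < K := by linarith
  refine ⟨δ / (16 * K), by positivity, ?_⟩
  have hw' : ∀ᶠ n in atTop, ∀ z ∈ Z, 𝔼 v, ∫ x, |w z (ψ n (x v)) - dist (x v) z|
      ∂(m n : Measure (S.V n → X)) < δ * ε / (16 * r) :=
    (Finset.eventually_all Z).2 fun z _ => hw z
  filter_upwards [hw'] with n hn
  set E : (S.V n → X) → ℝ := fun x => ∑ z ∈ Z, 𝔼 v, |w z (ψ n (x v)) - dist (x v) z| with hE
  have hi : ∀ z v, Integrable (fun x : S.V n → X => |w z (ψ n (x v)) - dist (x v) z|)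
      (m n : Measure (S.V n → X)) := fun z v =>
    integrable_comp_sub (m n : Measure (S.V n → X)) ((hψ n).comp (measurable_pi_apply v))
      (measurable_pi_apply v) (w z) ⟨fun x => dist x z, by fun_prop⟩
  have hi2 : ∀ z, Integrable (fun x : S.V n → X => 𝔼 v, |w z (ψ n (x v)) - dist (x v) z|)
      (m n : Measure (S.V n → X)) := fun z => by
    simp only [Fintype.expect_eq_sum_div_card]
    exact (integrable_finsetSum _ fun v _ => hi z v).div_const _
  have hE0 : ∀ x, 0 ≤ E x := fun x => Finset.sum_nonneg fun z _ => expect_nonneg fun v => abs_nonneg _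
  have hEi : Integrable E (m n : Measure (S.V n → X)) := integrable_finsetSum _ fun z _ => hi2 z
  have hEle : ∫ x, E x ∂(m n : Measure (S.V n → X)) < δ * ε / 16 := by
    rw [hE, integral_finsetSum _ fun z _ => hi2 z]
    calc _ ≤ ∑ _z ∈ Z, δ * ε / (16 * r) := by
          refine Finset.sum_le_sum fun z hz => ?_
          rw [integral_expect fun v => hi z v]
          exact (hn z hz).le
      _ = Z.card * (δ * ε / (16 * r)) := by simp
      _ < r * (δ * ε / (16 * r)) := by
          refine mul_lt_mul_of_pos_right ?_ (by positivity)
          rw [hr]; linarith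
      _ = δ * ε / 16 := by field_simp
  -- By Markov `E < δ / 8` outside measure `ε / 2`. For two such points the Hamming distance is at
  -- most `δ/8` from the net, `δ/8` from each `E`, `δ/16` from the moduli and `δ/8` from the images,
  -- less than `δ` in all.
  refine covNum_le_of_modulus (m n) (hψ n) (A := {x | E x < δ / 8}) ?_ fun x hx y hy hxy => ?_
  · have h1 := mul_meas_ge_le_integral_of_nonneg (Eventually.of_forall hE0) hEi (δ / 8)
    have h2 : {x | E x < δ / 8}ᶜ = {x | δ / 8 ≤ E x} := by ext; simp
    rw [h2]
    have h3 := h1.trans_lt hEle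
    have h4 : δ * ε / 16 = δ / 8 * (ε / 2) := by ring
    rw [h4] at h3
    exact lt_of_mul_lt_mul_left h3 (by positivity)
  · have h1 : ∀ v, dist (x v) (y v) ≤ 2 * (δ / 16) + (∑ z ∈ Z, |w z (ψ n (x v)) - dist (x v) z| +
        ∑ z ∈ Z, |w z (ψ n (y v)) - dist (y v) z| + (δ / 16 + K * dist (ψ n (x v)) (ψ n (y v)))) := by
      intro v
      refine (dist_le_add_sum_abs hZ _ _).trans (add_le_add_right ?_ _)
      have h2 : ∀ z ∈ Z, |dist (x v) z - dist (y v) z| ≤ |w z (ψ n (x v)) - dist (x v) z| +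
          |w z (ψ n (y v)) - dist (y v) z| +
            (δ / (16 * r) + C z * dist (ψ n (x v)) (ψ n (y v))) := by
        intro z _
        have h3 := abs_sub_le (dist (x v) z) (w z (ψ n (x v))) (dist (y v) z)
        have h4 := abs_sub_le (w z (ψ n (x v))) (w z (ψ n (y v))) (dist (y v) z)
        rw [abs_sub_comm (dist (x v) z) (w z (ψ n (x v)))] at h3
        have h5 := hC z (ψ n (x v)) (ψ n (y v))
        linarith
      refine (Finset.sum_le_sum h2).trans ?_
      rw [Finset.sum_add_distrib, Finset.sum_add_distrib, Finset.sum_add_distrib, ← Finset.sum_mul]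
      refine add_le_add_right (add_le_add ?_ ?_) _
      · rw [Finset.sum_const, nsmul_eq_mul]
        calc (Z.card : ℝ) * (δ / (16 * r)) ≤ r * (δ / (16 * r)) := by
              refine mul_le_mul_of_nonneg_right ?_ (by positivity)
              rw [hr]; linarith
          _ = δ / 16 := by field_simp
      · exact mul_le_mul_of_nonneg_right (by linarith) dist_nonneg
    have h2 : hammingAvg x y ≤ 2 * (δ / 16) + (E x + E y + (δ / 16 + K *
        hammingAvg (fun v => ψ n (x v)) (fun v => ψ n (y v)))) := by
      rw [hammingAvg_eq_expect, hammingAvg_eq_expect]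
      refine (expect_mono h1).trans_eq ?_
      simp only [Finset.expect_add_distrib, Fintype.expect_const, ← Finset.mul_expect, hE,
        Finset.expect_sum_comm]
    have h3 : K * hammingAvg (fun v => ψ n (x v)) (fun v => ψ n (y v)) ≤ K * (2 * (δ / (16 * K))) :=
      mul_le_mul_of_nonneg_left hxy.le hK0.le
    have h4 : K * (2 * (δ / (16 * K))) = δ / 8 := by field_simp; norm_num
    have hx' : E x < δ / 8 := hx
    have hy' : E y < δ / 8 := hy
    linarith

/-- The doubly-quenched entropy does not decrease under an isomorphism of alphabets. -/
theorem dqEntropy_le_dqEntropy_mapCoord (S : SoficApproximation G) {μ : ProbabilityMeasure (G → X)}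
    (hμ : ShiftInvariant μ) (φ : X ≃ᵐ Y) :
    dqEntropy S μ ≤ dqEntropy S (mapCoord φ.measurable μ) := by
  refine dqEntropy_le fun n hn m hm ε δ hε hδ => ?_
  obtain ⟨ψ, hψ, hψφ⟩ := hm.exists_approximates φ.measurable
  obtain ⟨δ', hδ', hle⟩ := hm.eventually_covNum_le φ hψ hψφ hε hδ
  refine le_trans (limsup_le_limsup ?_ (by isBoundedDefault) (by isBoundedDefault))
    (le_dqEntropy (hm.map_approximates hμ φ.measurable hψ hψφ) (half_pos hε) hδ')
  filter_upwards [hle] with i hi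
  exact covRate_mono hi

end Compare

/-! ### Independence of the metric, and the theorem for processes and systems. -/

section Entropies

variable {G : Type*} [Group G] [Countable G] {X : Type*} [MeasurableSpace X]

/-- The identity map is a Borel isomorphism between the two metric structures, though possibly not
continuous. -/
theorem processEntropy_le (S : SoficApproximation G) {μ : ProbabilityMeasure (G → X)}
    (hμ : ShiftInvariant μ) (d D : CompactGeneratingMetric X) :
    processEntropy S d μ ≤ processEntropy S D μ := by
  have h := @dqEntropy_le_dqEntropy_mapCoord X X d.toMetricSpace d.compactSpace _ d.borelSpace
    D.toMetricSpace D.compactSpace _ D.borelSpace G _ _ S μ hμ (MeasurableEquiv.refl X)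
  have e : mapCoord (MeasurableEquiv.refl X).measurable μ = μ :=
    Subtype.ext (Measure.map_id (μ := (μ : Measure (G → X))))
  rw [e] at h
  exact h

/-- The entropy of a process does not depend on the compact generating metric. -/
theorem processEntropy_eq (S : SoficApproximation G) {μ : ProbabilityMeasure (G → X)}
    (hμ : ShiftInvariant μ) (d D : CompactGeneratingMetric X) :
    processEntropy S d μ = processEntropy S D μ :=
  le_antisymm (processEntropy_le S hμ d D) (processEntropy_le S hμ D d)

/-- The supremum metric on a finite power. -/
noncomputable def CompactGeneratingMetric.pi (d : CompactGeneratingMetric X) (k : ℕ) :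
    CompactGeneratingMetric (Fin k → X) :=
  letI := d.toMetricSpace
  haveI := d.compactSpace
  haveI := d.borelSpace
  { toMetricSpace := inferInstance
    compactSpace := inferInstance
    borelSpace := inferInstance }

theorem ShiftInvariant.power {μ : ProbabilityMeasure (G → X)} (hμ : ShiftInvariant μ) (k : ℕ) :
    ShiftInvariant (power k μ) := by
  intro g
  have hg := measurePreserving_pi (fun _ : Fin k => (μ : Measure (G → X)))
    (fun _ => (μ : Measure (G → X))) fun _ => hμ g
  have hm : Measurable fun (x : G → Fin k → X) (h : G) => x (h * g) :=
    measurable_pi_lambda _ fun h => measurable_pi_apply (h * g)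
  refine ⟨hm, ?_⟩
  rw [SoficEntropy.power, ProbabilityMeasure.toMeasure_map, ProbabilityMeasure.toMeasure_pi,
    Measure.map_map hm (measurable_swapFun k)]
  conv_rhs => rw [← hg.map_eq, Measure.map_map (measurable_swapFun k) hg.measurable]
  rfl

/-- Independence of the metric replaces the arbitrary `D` by the supremum metric built from `d`, for
which additivity is known. -/
theorem processEntropy_power {k : ℕ} (hk : 1 ≤ k) (S : SoficApproximation G)
    {μ : ProbabilityMeasure (G → X)} (hμ : ShiftInvariant μ) (d : CompactGeneratingMetric X)
    (D : CompactGeneratingMetric (Fin k → X)) :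
    processEntropy S D (power k μ) = k * processEntropy S d μ := by
  rw [processEntropy_eq S (hμ.power k) D (d.pi k)]
  exact @dqEntropy_power G _ _ X d.toMetricSpace d.compactSpace _ d.borelSpace k hk S μ

/-- The right shift by `g` carries the orbit of `x` to the orbit of `g • x`, since `(h * g) • x = h
• g • x`. -/
theorem shiftInvariant_toProcess [MulAction G X] [MeasurableConstSMul G X]
    (μ : ProbabilityMeasure X) [SMulInvariantMeasure G X (μ : Measure X)] :
    ShiftInvariant (toProcess G μ) := by
  intro g
  have hm : Measurable fun (x : G → X) (h : G) => x (h * g) :=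
    measurable_pi_lambda _ fun h => measurable_pi_apply (h * g)
  refine ⟨hm, ?_⟩
  rw [toProcess, ProbabilityMeasure.toMeasure_map, Measure.map_map hm measurable_orbitMap]
  conv_rhs => rw [← (measurePreserving_smul g (μ : Measure X)).map_eq,
    Measure.map_map measurable_orbitMap (measurable_const_smul g)]
  congr 1
  ext x h
  simp [orbitMap, mul_smul]

theorem toProcess_pi [MulAction G X] [MeasurableConstSMul G X] (k : ℕ) (μ : ProbabilityMeasure X) :
    toProcess G (ProbabilityMeasure.pi fun _ : Fin k => μ) = power k (toProcess G μ) := by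
  apply Subtype.ext
  change (toProcess G (ProbabilityMeasure.pi fun _ : Fin k => μ) : Measure (G → Fin k → X)) =
    (power k (toProcess G μ) : Measure (G → Fin k → X))
  have hp := (measurePreserving_pi (fun _ : Fin k => (μ : Measure X))
    (fun _ => (toProcess G μ : Measure (G → X))) (f := fun _ => orbitMap) fun _ =>
      ⟨measurable_orbitMap (G := G), by rw [toProcess, ProbabilityMeasure.toMeasure_map]⟩)
  rw [toProcess, power, ProbabilityMeasure.toMeasure_map, ProbabilityMeasure.toMeasure_map,
    ProbabilityMeasure.toMeasure_pi, ProbabilityMeasure.toMeasure_pi, ← hp.map_eq,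
    Measure.map_map (measurable_swapFun k) hp.measurable]
  rfl

end Entropies

end SoficEntropy

theorem mainTheorem10 {G : Type*} [Group G] [Countable G]
    (S : SoficEntropy.SoficApproximation G) (k : ℕ) (hk : 1 ≤ k) :
    (∀ (X : Type*) [MeasurableSpace X] [StandardBorelSpace X] [MulAction G X]
        [MeasurableConstSMul G X] (μ : ProbabilityMeasure X)
        [SMulInvariantMeasure G X (μ : Measure X)]
        (d : SoficEntropy.CompactGeneratingMetric X)
        (D : SoficEntropy.CompactGeneratingMetric (Fin k → X)),
        SoficEntropy.systemEntropy S D (ProbabilityMeasure.pi fun _ : Fin k => μ) =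
          (k : EReal) * SoficEntropy.systemEntropy S d μ) ∧
    (∀ (X : Type*) [MeasurableSpace X] [StandardBorelSpace X]
        (μ : ProbabilityMeasure (G → X)) (_ : SoficEntropy.ShiftInvariant μ)
        (d : SoficEntropy.CompactGeneratingMetric X)
        (D : SoficEntropy.CompactGeneratingMetric (Fin k → X)),
        SoficEntropy.processEntropy S D (SoficEntropy.power k μ) =
          (k : EReal) * SoficEntropy.processEntropy S d μ) := by
  refine ⟨?_, fun X _ _ μ hμ d D => SoficEntropy.processEntropy_power hk S hμ d D⟩
  intro X _ _ _ _ μ _ d D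
  rw [SoficEntropy.systemEntropy, SoficEntropy.systemEntropy, SoficEntropy.toProcess_pi]
  exact SoficEntropy.processEntropy_power hk S (SoficEntropy.shiftInvariant_toProcess μ) d D
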